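/- **Setting.** Let $n\in\mathbb N$ particles have masses $m_1,\dots,m_n>0$ and positions $q_i\in\mathbb R^d$. Put $\langle x,y\rangle_{\mathcal M}=\sum_i m_i\langle x_i,y_i\rangle$, $\|x\|_{\mathcal M}=\langle x,x\rangle_{\mathcal M}^{1/2}$, $M=\{q\in(\mathbb R^{d})^n:\sum_i m_iq_i=0\}$, and let $\mathbb S\subseteq M$ be the unit sphere of $\|\cdot\|_{\mathcal M}$. Set partitions $\mathcal C$ of $N=\{1,\dots,n\}$ are ordered by refinement (coarser is larger), with join $\vee$ and largest element $\{N\}$. Put $\Delta_{\mathcal C}=\{q\in M: q_i=q_j \text{ if } i,j \text{ are in the same block of }\mathcal C\}$; let $q^E_{\mathcal C}$ be the orthogonal projection of $q$ to $\Delta_{\mathcal C}$ with respect to $\langle\cdot,\cdot\rangle_{\mathcal M}$, that is, each $q_i$ is replaced by the barycenter of its block. A *nondeterministic trajectory* is a continuous $q:I=(T^-,T^+)\to M$, $-\infty\le T^-<0<T^+\le\infty$, such that, with $\mathrm{CS}(t)$ the partition of $N$ into groups of particles with equal positions at time $t$: (1) if $T^\pm$ is finite, $\lim_{t\to T^\pm}q(t)$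 does not exist in $M$; (2) the momentum $p=\mathcal Mq'$ exists and is constant on each interval of times that contains no time at which $\mathrm{CS}$ is not locally constant; (3) for all $\tau\in I$ the curve $q^E_{\mathrm{CS}(\tau)}$ is $C^1$ near $\tau$ and its momentum $p^E_{\mathrm{CS}(\tau)}=\mathcal M(q^E_{\mathrm{CS}(\tau)})'$ is locally constant at $\tau$. Put $$R(t)=\|q(t)\|_{\mathcal M},\qquad P_R(t)=\frac{\langle p^E_{\mathrm{CS}(t)}(t),q(t)\rangle}{\|q(t)\|_{\mathcal M}} .$$ *Chain-closing times.* Put $T_0=0$. Given $T_{\ell-1}$, let $t_0=T_{\ell-1}$ and let $t_{k}$ be the least $t\in(t_{k-1},T^+)$ such that $\sup\mathrm{CS}([t_0,t])$ is strictly coarser than $\sup\mathrm{CS}([t_0,t_{k-1}])$, until $\sup\mathrm{CS}([t_0,t_{k_{\max}}])=\{N\}$; then $T_\ell=t_{k_{\max}}$. It is assumed that $T_\ell$ exists for all $\ell\in\mathbb N$. For the $\ell$-th chain put $$D_\ell=\min_{x\in\mathbb S}\ \max_{0\le j\le k_{\max}}\operatorname{dist}_{\mathbb S}\bigl(x,\Delta_{\mathrm{CS}(t_j)}\cap\mathbb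 S\bigr),$$ where $\operatorname{dist}_{\mathbb S}$ is the angular distance, and $D=\inf_{\ell\ge1}D_\ell$. Put $\Delta_\ell=T_\ell-T_{\ell-1}$ for $\ell\ge1$ and $$G_\ell=\#\{i\ge1: 2i\le\ell,\ \Delta_{2i-1}\le\Delta_{2i}\},\qquad U_\ell=\#\{i\ge1: 2i\le\ell,\ \Delta_{2i-1}\ge\Delta_{2i}\}.$$ **Theorem.** Let $q$ be a nondeterministic trajectory with chain-closing times $T_\ell$ as above and with $P_R(0)>0$. 1. $D\ge D_0$ for a constant $D_0>0$ that depends only on $n$ and the masses, and for all $\ell\in\mathbb N$ $$P_R(T_\ell)\ge P_R(0)\,(1+D^2)^{U_\ell},\qquad R(T_\ell)\ge R(0)\,(1+D^2)^{G_\ell}.$$ 2. There is a constant $C_P>1$ depending only on $n$ and the masses such that, if $\limsup_{\ell\to\infty}\Delta_\ell<\infty$, then $P_R(T_\ell)\ge A\,C_P^{\ell}$ for all but finitely many $\ell$, where $A>0$ depends only on $n$, the masses, $P_R(0)$, $R(0)$ and $\limsup_{\ell\to\infty}\Delta_\ell$. 3. There is a constant $C_R>1$ depending only on $n$ and the masses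 such that, if $d=1$ and the order of the particles never changes (if $q_i(s)<q_j(s)$ for some time $s\in[0,T^+)$, then $q_i(t)\le q_j(t)$ for all $t\in[0,T^+)$), then $R(T_\ell)\ge C_R\,R(T_{\ell-1})$ for all $\ell\ge1$. -/

import Mathlib

open Filter Topology

noncomputable section

namespace Nondet

/-- Positions of `n` particles in `ℝ^d`. Only the topology and the differentiable structure of this
product are used; lengths and angles are those of the mass inner product below. -/
abbrev Config (n d : ℕ) : Type := Fin n → EuclideanSpace ℝ (Fin d)

section Configuration

variable {n d : ℕ}

/-- The inner product `⟨x, y⟩_𝓜 = ∑ i, m i ⟨x i, y i⟩` given by the mass matrix. -/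
def massInner (m : Fin n → ℝ) (x y : Config n d) : ℝ := ∑ i, m i * inner ℝ (x i) (y i)

/-- The norm `‖x‖_𝓜`. -/
def massNorm (m : Fin n → ℝ) (x : Config n d) : ℝ := Real.sqrt (massInner m x x)

/-- Multiplication of a velocity by the mass matrix. -/
def momentum (m : Fin n → ℝ) (v : Config n d) : Config n d := fun i => m i • v i

/-- The canonical pairing `⟨p, q⟩` of a momentum and a position. -/
def pairing (p q : Config n d) : ℝ := ∑ i, inner ℝ (p i) (q i)

/-- The center of mass configuration space `M`. -/
def centered (d : ℕ) (m : Fin n → ℝ) : Submodule ℝ (Config n d) where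
  carrier := {q | ∑ k, m k • q k = 0}
  zero_mem' := by simp
  add_mem' := by
    intro a b ha hb
    simp only [Set.mem_ofPred_eq] at ha hb ⊢
    simp [smul_add, Finset.sum_add_distrib, ha, hb]
  smul_mem' := by
    intro c a ha
    simp only [Set.mem_ofPred_eq] at ha ⊢
    simp only [Pi.smul_apply, smul_comm _ c]
    rw [← Finset.smul_sum, ha, smul_zero]

/-- The collision subspace `Δ_C ⊆ M` of a set partition `C` of the particles. Set partitions are
given by their equivalence relations; `C ≤ C'` says that `C` is finer than `C'`, `⊥` is the
partition into singletons and `⊤` is the partition with one block. -/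
def collisionSubspace (d : ℕ) (m : Fin n → ℝ) (C : Setoid (Fin n)) :
    Submodule ℝ (Config n d) where
  carrier := {q | q ∈ centered d m ∧ ∀ i j, C i j → q i = q j}
  zero_mem' := ⟨Submodule.zero_mem _, fun _ _ _ => rfl⟩
  add_mem' := by
    rintro a b ⟨ha, ha'⟩ ⟨hb, hb'⟩
    exact ⟨Submodule.add_mem _ ha hb, fun i j h => by simp [ha' i j h, hb' i j h]⟩
  smul_mem' := by
    rintro c a ⟨ha, ha'⟩
    exact ⟨Submodule.smul_mem _ c ha, fun i j h => by simp [ha' i j h]⟩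

/-- `Ξ_C`: the points of `Δ_C` that are in no `Δ_C'` for a strictly coarser `C'`. -/
def stratum (d : ℕ) (m : Fin n → ℝ) (C : Setoid (Fin n)) : Set (Config n d) :=
  {q | q ∈ collisionSubspace d m C ∧ ∀ C', C < C' → q ∉ collisionSubspace d m C'}

/-- The set partition of the particles into groups with equal positions. -/
def clusters (q : Config n d) : Setoid (Fin n) := Setoid.ker q

/-- `clusters q` is the partition that is determined by `q ∈ Ξ_C`. -/
theorem mem_stratum_iff (m : Fin n → ℝ) (C : Setoid (Fin n)) {q : Config n d}
    (hq : q ∈ centered d m) : q ∈ stratum d m C ↔ clusters q = C := by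
  have key : ∀ C', q ∈ collisionSubspace d m C' ↔ C' ≤ clusters q := fun C' =>
    ⟨fun h i j hij => h.2 i j hij, fun h => ⟨hq, fun i j hij => h hij⟩⟩
  simp only [stratum, Set.mem_ofPred_eq, key]
  constructor
  · rintro ⟨h1, h2⟩
    by_contra hne
    exact h2 _ (lt_of_le_of_ne h1 (Ne.symm hne)) le_rfl
  · rintro rfl
    exact ⟨le_rfl, fun C' h => not_le_of_gt h⟩

open Classical in
/-- The external projection `Π^E_C`: every particle is moved to the barycenter of its cluster. -/
def extProj (m : Fin n → ℝ) (C : Setoid (Fin n)) (q : Config n d) : Config n d := fun i =>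
  (∑ j with C i j, m j)⁻¹ • ∑ j with C i j, m j • q j

/-- The unit sphere `𝕊` of `M`. -/
def unitSphere (d : ℕ) (m : Fin n → ℝ) : Set (Config n d) :=
  {x | x ∈ centered d m ∧ massNorm m x = 1}

/-- Angular distance of a point of the unit sphere from a nonempty subset of the unit sphere. -/
def sphereDist (m : Fin n → ℝ) (x : Config n d) (A : Set (Config n d)) : ℝ :=
  ⨅ y : A, Real.arccos (massInner m x y)

/-- For partitions `C 0, …, C K`, the minimum over the points `x` of the unit sphere of the
maximum over `j ≤ K` of the angular distance of `x` from `Δ_{C j} ∩ 𝕊`. -/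
def sphereConst (d : ℕ) (m : Fin n → ℝ) (K : ℕ) (C : ℕ → Setoid (Fin n)) : ℝ :=
  ⨅ x : unitSphere d m, ⨆ j : Fin (K + 1),
    sphereDist m (x : Config n d) ((collisionSubspace d m (C j) : Set _) ∩ unitSphere d m)

end Configuration

section Trajectories

variable {n d : ℕ}

/-- The open time interval with the given, possibly infinite, ends. -/
def timeInterval (a b : EReal) : Set ℝ := {t | a < (t : EReal) ∧ (t : EReal) < b}

/-- The times in `I` at which the partition into clusters is not locally constant. -/
def changeTimes (I : Set ℝ) (q : ℝ → Config n d) : Set ℝ :=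
  {t | t ∈ I ∧ ¬ ∀ᶠ s in 𝓝 t, clusters (q s) = clusters (q t)}

/-- The external momentum `p^E_C = 𝓜 (q^E_C)'` of a curve, for a fixed partition `C`. -/
def extMomentum (m : Fin n → ℝ) (C : Setoid (Fin n)) (q : ℝ → Config n d) (t : ℝ) :
    Config n d :=
  momentum m (deriv (fun s => extProj m C (q s)) t)

/-- Nondeterministic trajectories of particles with masses `m` in dimension `d`. The values of
`q` outside the time interval are irrelevant. -/
structure Trajectory (d : ℕ) (m : Fin n → ℝ) where
  /-- The escape time in the past. -/
  Tminus : EReal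
  /-- The escape time in the future. -/
  Tplus : EReal
  /-- The curve. -/
  q : ℝ → Config n d
  Tminus_neg : Tminus < 0
  Tplus_pos : 0 < Tplus
  mem_centered : ∀ t ∈ timeInterval Tminus Tplus, q t ∈ centered d m
  continuousOn : ContinuousOn q (timeInterval Tminus Tplus)
  escape_plus : Tplus ≠ ⊤ → ¬ ∃ x ∈ centered d m, Tendsto q (𝓝[<] Tplus.toReal) (𝓝 x)
  escape_minus : Tminus ≠ ⊥ → ¬ ∃ x ∈ centered d m, Tendsto q (𝓝[>] Tminus.toReal) (𝓝 x)
  momentum_const : ∀ J : Set ℝ, J.OrdConnected →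
    J ⊆ timeInterval Tminus Tplus \ changeTimes (timeInterval Tminus Tplus) q →
    ∃ p, ∀ t ∈ J, DifferentiableAt ℝ q t ∧ momentum m (deriv q t) = p
  ext_free : ∀ τ ∈ timeInterval Tminus Tplus, ∃ a b : ℝ, τ ∈ Set.Ioo a b ∧
    Set.Ioo a b ⊆ timeInterval Tminus Tplus ∧
    ContDiffOn ℝ 1 (fun t => extProj m (clusters (q τ)) (q t)) (Set.Ioo a b) ∧
    ∀ᶠ t in 𝓝 τ, extMomentum m (clusters (q τ)) q t = extMomentum m (clusters (q τ)) q τ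

namespace Trajectory

variable {m : Fin n → ℝ}

/-- The time interval `(T⁻, T⁺)`. -/
def I (γ : Trajectory d m) : Set ℝ := timeInterval γ.Tminus γ.Tplus

/-- The collision set `CS(t)`. -/
def CS (γ : Trajectory d m) (t : ℝ) : Setoid (Fin n) := clusters (γ.q t)

/-- The radius `R(t) = ‖q(t)‖_𝓜`. -/
def R (γ : Trajectory d m) (t : ℝ) : ℝ := massNorm m (γ.q t)

/-- The radial momentum `P_R(t) = ⟨p, q⟩(t) / ‖q(t)‖_𝓜`, with `⟨p, q⟩(t) = ⟨p^E_CS(t), q(t)⟩`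
at every time, change times included. -/
def PR (γ : Trajectory d m) (t : ℝ) : ℝ :=
  pairing (extMomentum m (γ.CS t) γ.q t) (γ.q t) / massNorm m (γ.q t)

/-- The join of the partitions `CS(u)` for `u ∈ [s, r]`. -/
def joinCS (γ : Trajectory d m) (s r : ℝ) : Setoid (Fin n) := ⨆ u ∈ Set.Icc s r, γ.CS u

/-- `t 0, …, t K` are the successive times, starting with `t 0 = s`, at which the join of all
partitions met since `s` becomes strictly coarser; with `t K` it reaches the one-block
partition. -/
structure IsChain (γ : Trajectory d m) (s : ℝ) (K : ℕ) (t : ℕ → ℝ) : Prop where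
  start : t 0 = s
  step : ∀ k < K,
    IsLeast {r | r ∈ γ.I ∧ t k < r ∧ γ.joinCS s (t k) < γ.joinCS s r} (t (k + 1))
  closed : γ.joinCS s (t K) = ⊤

/-- `T` is the sequence of chain-closing times: `T 0 = 0`, and `T (ℓ + 1)` is the last of the
times `t ℓ 0, …, t ℓ (K ℓ)` of the chain that starts at `T ℓ`. -/
structure IsChainClosing (γ : Trajectory d m) (T : ℕ → ℝ) (K : ℕ → ℕ) (t : ℕ → ℕ → ℝ) :
    Prop where
  zero : T 0 = 0
  chain : ∀ ℓ, γ.IsChain (T ℓ) (K ℓ) (t ℓ)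
  succ : ∀ ℓ, T (ℓ + 1) = t ℓ (K ℓ)

/-- The smallest over all chains of the sphere constant of the partitions
`CS(t ℓ 0), …, CS(t ℓ (K ℓ))` of the chain. -/
def chainConst (γ : Trajectory d m) (K : ℕ → ℕ) (t : ℕ → ℕ → ℝ) : ℝ :=
  ⨅ ℓ, sphereConst d m (K ℓ) (fun j => γ.CS (t ℓ j))

/-- On a line, the order of the particles never changes (at nonnegative times). -/
def OrderPreserving {m : Fin n → ℝ} (γ : Trajectory 1 m) : Prop :=
  ∀ s ∈ γ.I, ∀ t ∈ γ.I, 0 ≤ s → 0 ≤ t → ∀ i j : Fin n,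
    γ.q s i 0 < γ.q s j 0 → γ.q t i 0 ≤ γ.q t j 0

end Trajectory

/-- The gaps `Δ_ℓ = T_ℓ - T_{ℓ-1}`, `ℓ ≥ 1`. -/
def gap (T : ℕ → ℝ) (ℓ : ℕ) : ℝ := T ℓ - T (ℓ - 1)

/-- `G_ℓ`. -/
def countG (T : ℕ → ℝ) (ℓ : ℕ) : ℕ :=
  {i : ℕ | 1 ≤ i ∧ 2 * i ≤ ℓ ∧ gap T (2 * i - 1) ≤ gap T (2 * i)}.ncard

/-- `U_ℓ`. -/
def countU (T : ℕ → ℝ) (ℓ : ℕ) : ℕ :=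
  {i : ℕ | 1 ≤ i ∧ 2 * i ≤ ℓ ∧ gap T (2 * i) ≤ gap T (2 * i - 1)}.ncard

end Trajectories

end Nondet

end

/-! The masses are absorbed into a Euclidean inner product. At a time τ, q(τ) lies in the subspace
V(τ) of configurations constant on the clusters, the V(τ)-component of q moves uniformly for a short
time, and V(t) contains V(τ) for t near τ. Hence ⟨q(t), q(τ)⟩ is affine in t near τ, so R has a
supporting line of slope P_R(τ): R is convex and P_R is nondecreasing.

Quantitatively, P_R grows at least at the rate R·(angular speed)². Cauchy–Schwarz then bounds the
cost of turning by an angle θ during [a,b] from below: θ²R(a) ≤ (P_R(b) - P_R(a))(b - a) if P_R(a) ≥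
0 (`IsFree.angle_sq_mul_norm_le`). The partitions of a chain have join {N}, so no direction is close
to all their collision subspaces (`exists_sphereConst_ge`); q therefore turns by at least D between
the start of the chain and one of its times.

Each chain thus gives D²R ≤ ΔP·ΔT, and convexity gives ΔR ≥ P·ΔT (`IsGrowing`). Over two successive
chains, P gains the factor 1 + D² if the second gap is the shorter one, and R gains it if the second
gap is the longer one. The product PR grows in either case, and bounded gaps turn this into growth
of P alone. On a line with fixed order, Chebyshev's inequality makes t ↦ ⟨q(t), q(s)⟩ convex, so it
stays above R(s)²; together with the turning by D this yields R ≥ R(s)/cos D at the end of the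
chain. -/

namespace Nondet

/-! ### Convexity from local supporting lines. -/

section Convexity

/-- A continuous function with a local supporting line at every interior point of an interval lies
below its chord. -/
theorem le_chord_of_local_support {f : ℝ → ℝ} {a b : ℝ} (hab : a < b)
    (hf : ContinuousOn f (Set.Icc a b))
    (hs : ∀ τ ∈ Set.Ioo a b, ∃ s, ∀ᶠ t in 𝓝 τ, f τ + s * (t - τ) ≤ f t) {t : ℝ}
    (ht : t ∈ Set.Icc a b) : f t ≤ f a + (f b - f a) / (b - a) * (t - a) := by
  set k := (f b - f a) / (b - a) with hk
  have hba : b - a ≠ 0 := (sub_pos.2 hab).ne'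
  have hkb : k * (b - a) = f b - f a := div_mul_cancel₀ _ hba
  set g : ℝ → ℝ := fun t => f t - f a - k * (t - a) with hg
  have hgc : ContinuousOn g (Set.Icc a b) := by fun_prop
  obtain ⟨c₀, hc₀, hmax⟩ :=
    isCompact_Icc.exists_isMaxOn (Set.nonempty_Icc.2 hab.le) hgc
  by_contra! hlt
  have hpos : 0 < g c₀ := lt_of_lt_of_le (by simp only [hg]; linarith) (hmax ht)
  -- The last maximum point c of `g` gives the contradiction: a supporting line at an interior
  -- maximum is horizontal, so the maximum is also attained to the right of c.
  have hZ : IsCompact (Set.Icc a b ∩ g ⁻¹' {g c₀}) :=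
    isCompact_Icc.of_isClosed_subset
      (hgc.preimage_isClosed_of_isClosed isClosed_Icc isClosed_singleton) Set.inter_subset_left
  obtain ⟨c, hc⟩ := hZ.exists_isGreatest ⟨c₀, hc₀, rfl⟩
  have hgc0 : g c = g c₀ := hc.1.2
  have hca : a < c := by
    refine lt_of_le_of_ne hc.1.1.1 ?_
    rintro rfl
    simp [hg] at hgc0
    simp only [hg] at hpos
    linarith
  have hcb : c < b := by
    refine lt_of_le_of_ne hc.1.1.2 ?_
    rintro rfl
    have : g c = 0 := by simp only [hg]; linarith
    linarith
  obtain ⟨s, hs⟩ := hs c ⟨hca, hcb⟩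
  have hle : ∀ᶠ t in 𝓝 c,
      (s - k) * (t - c) ≤ 0 ∧ g c + (s - k) * (t - c) ≤ g t ∧ t ∈ Set.Icc a b := by
    filter_upwards [hs, Icc_mem_nhds hca hcb] with t h1 h2
    have h3 : g t ≤ g c := by rw [hgc0]; exact hmax h2
    have h4 : g c + (s - k) * (t - c) ≤ g t := by simp only [hg]; linarith
    exact ⟨by linarith, h4, h2⟩
  obtain ⟨ε, hε, hball⟩ := Metric.eventually_nhds_iff.1 hle
  have h1 := hball (y := c + ε / 2) (by simp [abs_of_pos hε]; linarith)
  have h2 := hball (y := c - ε / 2) (by simp [abs_of_pos hε]; linarith)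
  have h0 : (s - k) * (ε / 2) = 0 := by
    have := h1.1
    have := h2.1
    apply le_antisymm <;> nlinarith
  have h5 : g (c + ε / 2) = g c₀ := by
    apply le_antisymm (hmax h1.2.2)
    have := h1.2.1
    rw [add_sub_cancel_left, h0] at this
    linarith
  have := hc.2 ⟨h1.2.2, h5⟩
  linarith

theorem convexOn_of_local_support {S : Set ℝ} (hS : Convex ℝ S) {f : ℝ → ℝ}
    (hf : ContinuousOn f S)
    (hs : ∀ τ ∈ interior S, ∃ s, ∀ᶠ t in 𝓝 τ, f τ + s * (t - τ) ≤ f t) : ConvexOn ℝ S f := by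
  refine LinearOrder.convexOn_of_lt hS fun x hx y hy hxy a b ha hb hab => ?_
  have hsub : Set.Icc x y ⊆ S := hS.ordConnected.out hx hy
  have hsub' : Set.Ioo x y ⊆ interior S :=
    interior_maximal (Set.Ioo_subset_Icc_self.trans hsub) isOpen_Ioo
  have hz : a • x + b • y ∈ Set.Icc x y := by
    obtain rfl : a = 1 - b := by linarith
    simp only [smul_eq_mul]
    constructor <;> nlinarith [mul_pos hb (sub_pos.2 hxy), mul_pos ha (sub_pos.2 hxy)]
  have h := le_chord_of_local_support hxy (hf.mono hsub) (fun τ hτ => hs τ (hsub' hτ)) hz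
  refine h.trans (le_of_eq ?_)
  have : y - x ≠ 0 := (sub_pos.2 hxy).ne'
  obtain rfl : a = 1 - b := by linarith
  simp only [smul_eq_mul]
  field_simp
  ring

/-- Subtracting the line turns local support into a local minimum, which convexity makes global. -/
theorem _root_.ConvexOn.add_mul_sub_le {S : Set ℝ} {f : ℝ → ℝ} (hf : ConvexOn ℝ S f) {τ s : ℝ}
    (hτ : τ ∈ S) (hs : ∀ᶠ t in 𝓝[S] τ, f τ + s * (t - τ) ≤ f t) {t : ℝ} (ht : t ∈ S) :
    f τ + s * (t - τ) ≤ f t := by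
  have hconv : ConvexOn ℝ S (fun t => f t + (-s) * t) :=
    hf.add (((LinearMap.mulLeft ℝ (-s)).convexOn hf.1))
  have hmin : IsLocalMinOn (fun t => f t + (-s) * t) S τ := by
    filter_upwards [hs] with t ht
    linarith
  have := IsMinOn.of_isLocalMinOn_of_convexOn hτ hmin hconv ht
  simp only [Set.mem_ofPred_eq] at this
  linarith

/-- A function `P + g` with `P` monotone and `g` continuous does not decrease over an interval if
its lower right derivative is nonnegative. -/
theorem le_of_lower_right_deriv_nonneg {P g : ℝ → ℝ} {a b : ℝ} (hab : a ≤ b)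
    (hP : MonotoneOn P (Set.Icc a b)) (hg : ContinuousOn g (Set.Icc a b))
    (hd : ∀ τ ∈ Set.Ico a b, ∀ ε > 0,
      ∀ᶠ t in 𝓝[>] τ, P τ + g τ - ε * (t - τ) ≤ P t + g t) :
    P a + g a ≤ P b + g b := by
  have key : ∀ ε > 0, P a + g a - ε * (b - a) ≤ P b + g b := by
    intro ε hε
    set S := {t | t ∈ Set.Icc a b ∧ P a + g a - ε * (t - a) ≤ P t + g t} with hS
    have haS : a ∈ S := ⟨⟨le_rfl, hab⟩, by simp⟩
    have hbdd : BddAbove S := ⟨b, fun t ht => ht.1.2⟩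
    set c := sSup S with hc
    have hcm : c ∈ closure S := csSup_mem_closure ⟨a, haS⟩ hbdd
    have hac : a ≤ c := le_csSup hbdd haS
    have hcb : c ≤ b := csSup_le ⟨a, haS⟩ fun t ht => ht.1.2
    -- `P` may jump at c, but only upwards, so the inequality still passes to the supremum.
    have hcS : c ∈ S := by
      refine ⟨⟨hac, hcb⟩, ?_⟩
      have h1 : ContinuousWithinAt (fun t => P a + g a - ε * (t - a) - g t) S c := by
        have : ContinuousWithinAt g S c := (hg c ⟨hac, hcb⟩).mono fun t ht => ht.1
        fun_prop
      have h2 := h1.closure_le (g := fun _ => P c) hcm continuousWithinAt_const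
        (fun t ht => by
          have := hP ht.1 ⟨hac, hcb⟩ (le_csSup hbdd ht)
          have := ht.2
          linarith)
      linarith
    rcases hcb.eq_or_lt with h | h
    · rw [← h]; exact hcS.2
    · exfalso
      have h3 := hd c ⟨hac, h⟩ ε hε
      obtain ⟨t, ht, htb⟩ := (h3.and (Ioo_mem_nhdsGT h)).exists
      have : t ∈ S := ⟨⟨hac.trans htb.1.le, htb.2.le⟩, by linarith [hcS.2]⟩
      exact absurd (le_csSup hbdd this) (not_le.2 htb.1)
  refine le_of_forall_pos_le_add fun ε hε => ?_
  have h := key (ε / (b - a + 1)) (by have := sub_nonneg.2 hab; positivity)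
  have h2 : ε / (b - a + 1) * (b - a) ≤ ε := by
    rw [div_mul_eq_mul_div, div_le_iff₀ (by linarith)]
    nlinarith
  linarith

end Convexity

theorem arccos_le_sqrt_div {u : ℝ} (hu : 0 < u) : Real.arccos u ≤ Real.sqrt (1 - u ^ 2) / u := by
  rcases le_or_gt u 1 with h | h
  · have := Real.le_tan (Real.arccos_nonneg u) (Real.arccos_lt_pi_div_two.2 hu)
    rwa [Real.tan_arccos] at this
  · rw [Real.arccos_of_one_le h.le]
    positivity

end Nondet
-- Radius and angle of free curves in an inner product space.
namespace Nondet

section FreeCurve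

variable {E : Type*} [NormedAddCommGroup E] [InnerProductSpace ℝ E]

/-- A curve `x` such that at every time `τ ∈ I` the component of `x` in a subspace `V τ ∋ x τ`
moves with constant velocity `w τ` for a short time. -/
structure IsFree (x : ℝ → E) (I : Set ℝ) (V : ℝ → Submodule ℝ E) (w : ℝ → E) : Prop where
  isOpen : IsOpen I
  ordConnected : I.OrdConnected
  continuousOn : ContinuousOn x I
  mem : ∀ τ ∈ I, x τ ∈ V τ
  velocity_mem : ∀ τ ∈ I, w τ ∈ V τ
  inner_eq : ∀ τ ∈ I, ∀ᶠ t in 𝓝 τ, ∀ z ∈ V τ,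
    inner ℝ (x t) z = inner ℝ (x τ) z + (t - τ) * inner ℝ (w τ) z
  le : ∀ τ ∈ I, ∀ᶠ t in 𝓝 τ, V τ ≤ V t

/-- If `⟨x t, x τ⟩` is affine in `t` near `τ`, with the slope `s`, then `‖x‖` has a supporting line
at `τ`. -/
theorem norm_local_support {x : ℝ → E} {τ s : ℝ}
    (h : ∀ᶠ t in 𝓝 τ, inner ℝ (x t) (x τ) = inner ℝ (x τ) (x τ) + s * (t - τ)) :
    ∀ᶠ t in 𝓝 τ, ‖x τ‖ + s / ‖x τ‖ * (t - τ) ≤ ‖x t‖ := by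
  filter_upwards [h] with t ht
  rcases eq_or_ne (x τ) 0 with h0 | h0
  · simp [h0]
  · have hp : 0 < ‖x τ‖ := norm_pos_iff.2 h0
    have h1 := real_inner_le_norm (x t) (x τ)
    rw [ht, real_inner_self_eq_norm_sq] at h1
    refine le_of_mul_le_mul_right (le_trans (le_of_eq ?_) h1) hp
    field_simp

theorem norm_convexOn {x : ℝ → E} {S : Set ℝ} (hS : Convex ℝ S) (hx : ContinuousOn x S)
    (h : ∀ τ ∈ interior S, ∃ s, ∀ᶠ t in 𝓝 τ,
      inner ℝ (x t) (x τ) = inner ℝ (x τ) (x τ) + s * (t - τ)) :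
    ConvexOn ℝ S fun t => ‖x t‖ :=
  convexOn_of_local_support hS hx.norm fun τ hτ =>
    (h τ hτ).imp' (fun s => s / ‖x τ‖) fun _ hs => norm_local_support hs

namespace IsFree

variable {x : ℝ → E} {I : Set ℝ} {V : ℝ → Submodule ℝ E} {w : ℝ → E}

/-- The radial velocity of `x`. -/
noncomputable def radial (x w : ℝ → E) (t : ℝ) : ℝ := inner ℝ (w t) (x t) / ‖x t‖

theorem inner_self_eq (hx : IsFree x I V w) {τ : ℝ} (hτ : τ ∈ I) :
    ∀ᶠ t in 𝓝 τ, inner ℝ (x t) (x τ) =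
      inner ℝ (x τ) (x τ) + inner ℝ (w τ) (x τ) * (t - τ) := by
  filter_upwards [hx.inner_eq τ hτ] with t ht
  rw [ht _ (hx.mem τ hτ), mul_comm]

theorem convexOn_norm (hx : IsFree x I V w) : ConvexOn ℝ I fun t => ‖x t‖ :=
  norm_convexOn hx.ordConnected.convex hx.continuousOn fun _ hτ =>
    ⟨_, hx.inner_self_eq (interior_subset hτ)⟩

theorem norm_add_radial_le (hx : IsFree x I V w) {τ t : ℝ} (hτ : τ ∈ I) (ht : t ∈ I) :
    ‖x τ‖ + radial x w τ * (t - τ) ≤ ‖x t‖ :=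
  hx.convexOn_norm.add_mul_sub_le hτ
    ((norm_local_support (hx.inner_self_eq hτ)).filter_mono nhdsWithin_le_nhds) ht

theorem radial_monotoneOn (hx : IsFree x I V w) : MonotoneOn (radial x w) I := by
  intro s hs t ht hst
  rcases hst.eq_or_lt with rfl | hlt
  · rfl
  · have h1 := hx.norm_add_radial_le hs ht
    have h2 := hx.norm_add_radial_le ht hs
    have : (radial x w s - radial x w t) * (t - s) ≤ 0 := by linarith
    nlinarith

/-- The norm of the component transversal to the subspace `V τ` has a right derivative at `τ`. -/
theorem exists_tendsto_transversal (hx : IsFree x I V w) {τ : ℝ} (hτ : τ ∈ I) :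
    ∃ ν : ℝ, Tendsto (fun t => ‖x t - x τ - (t - τ) • w τ‖ / (t - τ)) (𝓝[>] τ) (𝓝 ν) := by
  obtain ⟨l, u, hlu, hIoo⟩ := mem_nhds_iff_exists_Ioo_subset.1
    (Filter.inter_mem (hx.isOpen.mem_nhds hτ) (hx.le τ hτ))
  -- The transversal part at σ lies in `V σ`, because `V τ ≤ V σ`. Its inner product with its own
  -- value at σ is therefore affine near σ, and its norm is convex, like that of `x`; a convex
  -- function has right derivatives.
  have hconv : ConvexOn ℝ (Set.Ioo l u) fun t => ‖x t - x τ - (t - τ) • w τ‖ := by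
    refine norm_convexOn (x := fun t => x t - x τ - (t - τ) • w τ) (convex_Ioo l u) ?_ ?_
    · have := hx.continuousOn.mono (hIoo.trans Set.inter_subset_left)
      fun_prop
    · intro σ hσ
      rw [interior_Ioo] at hσ
      have hσI := (hIoo hσ).1
      have hV : V τ ≤ V σ := (hIoo hσ).2
      have hz : x σ - x τ - (σ - τ) • w τ ∈ V σ :=
        Submodule.sub_mem _ (Submodule.sub_mem _ (hx.mem σ hσI) (hV (hx.mem τ hτ)))
          (Submodule.smul_mem _ _ (hV (hx.velocity_mem τ hτ)))
      refine ⟨inner ℝ (w σ - w τ) (x σ - x τ - (σ - τ) • w τ), ?_⟩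
      filter_upwards [hx.inner_eq σ hσI] with t ht
      have := ht _ hz
      set z := x σ - x τ - (σ - τ) • w τ with hzdef
      have e : inner ℝ z z = inner ℝ (x σ) z - inner ℝ (x τ) z - (σ - τ) * inner ℝ (w τ) z := by
        have e : ∀ y, inner ℝ (x σ - x τ - (σ - τ) • w τ) y =
            inner ℝ (x σ) y - inner ℝ (x τ) y - (σ - τ) * inner ℝ (w τ) y := fun y => by
          simp only [inner_sub_left, real_inner_smul_left]
        exact e z
      rw [e]
      simp only [inner_sub_left, real_inner_smul_left]
      rw [this]
      ring
  have hd := hconv.hasDerivWithinAt_rightDeriv_of_mem_interior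
    (x := τ) (by rw [interior_Ioo]; exact hlu)
  refine ⟨_, (hasDerivWithinAt_iff_tendsto_slope' (by simp)).1 hd |>.congr fun t => ?_⟩
  simp [slope_def_field]

end IsFree

end FreeCurve

end Nondet
namespace Nondet
namespace IsFree

variable {E : Type*} [NormedAddCommGroup E] [InnerProductSpace ℝ E]
variable {x : ℝ → E} {I : Set ℝ} {V : ℝ → Submodule ℝ E} {w : ℝ → E}

/-- Pythagoras: near τ the transversal part is orthogonal to `V τ`, which contains `x τ` and `w τ`.
The rest is completing the square. -/
theorem norm_sq_eq (hx : IsFree x I V w) {τ : ℝ} (hτ : τ ∈ I) (h0 : x τ ≠ 0) :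
    ∀ᶠ t in 𝓝 τ, ‖x t‖ ^ 2 = (‖x τ‖ + radial x w τ * (t - τ)) ^ 2 +
      ((‖w τ‖ ^ 2 - radial x w τ ^ 2) * (t - τ) ^ 2 + ‖x t - x τ - (t - τ) • w τ‖ ^ 2) := by
  filter_upwards [hx.inner_eq τ hτ] with t ht
  have hp : ‖x τ‖ ≠ 0 := norm_ne_zero_iff.2 h0
  have h1 := ht _ (hx.mem τ hτ)
  have h2 := ht _ (hx.velocity_mem τ hτ)
  have h3 : radial x w τ * ‖x τ‖ = inner ℝ (w τ) (x τ) := div_mul_cancel₀ _ hp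
  rw [norm_sub_sq_real, norm_sub_sq_real, inner_sub_left, real_inner_smul_right,
    real_inner_smul_right, norm_smul, mul_pow, Real.norm_eq_abs, sq_abs, h1, h2,
    real_inner_self_eq_norm_sq, real_inner_self_eq_norm_sq, real_inner_comm (w τ) (x τ), ← h3]
  ring

/-- Near a time `τ` of nonzero radius, to the right of `τ`, the radius deviates quadratically from
its supporting line, and the coefficient controls the angular speed. -/
theorem exists_angular_speed (hx : IsFree x I V w) {τ : ℝ} (hτ : τ ∈ I) (h0 : x τ ≠ 0) :
    ∃ c : ℝ, 0 ≤ c ∧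
      Tendsto (fun t => (‖x t‖ - ‖x τ‖ - radial x w τ * (t - τ)) / (t - τ) ^ 2) (𝓝[>] τ)
        (𝓝 (‖x τ‖ * c ^ 2 / 2)) ∧
      ∀ ε > 0, ∀ᶠ t in 𝓝[>] τ,
        InnerProductGeometry.angle (x τ) (x t) ≤ (c + ε) * (t - τ) := by
  obtain ⟨ν, hν⟩ := hx.exists_tendsto_transversal hτ
  have hp : 0 < ‖x τ‖ := norm_pos_iff.2 h0
  set r := ‖x τ‖ with hr
  set P := radial x w τ with hP
  have hPw : P ^ 2 ≤ ‖w τ‖ ^ 2 := by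
    rw [sq_le_sq, abs_norm, hP, radial, abs_div, abs_norm, div_le_iff₀ hp]
    exact abs_real_inner_le_norm _ _
  set κ : ℝ → ℝ := fun t => (‖w τ‖ ^ 2 - P ^ 2) * (t - τ) ^ 2 +
    ‖x t - x τ - (t - τ) • w τ‖ ^ 2 with hκ
  set β := ‖w τ‖ ^ 2 - P ^ 2 + ν ^ 2 with hβ
  have hβ0 : 0 ≤ β := by have := sq_nonneg ν; linarith
  have hκ0 : ∀ t, 0 ≤ κ t := fun t => by
    have := sub_nonneg.2 hPw
    positivity
  have hκlim : Tendsto (fun t => κ t / (t - τ) ^ 2) (𝓝[>] τ) (𝓝 β) := by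
    refine Tendsto.congr' ?_ ((hν.pow 2).const_add (‖w τ‖ ^ 2 - P ^ 2))
    filter_upwards [self_mem_nhdsWithin] with t ht
    have : t - τ ≠ 0 := (sub_pos.2 ht).ne'
    simp only [hκ]
    field_simp
  have hR : ∀ᶠ t in 𝓝[>] τ, ‖x t‖ ^ 2 = (r + P * (t - τ)) ^ 2 + κ t :=
    (hx.norm_sq_eq hτ h0).filter_mono nhdsWithin_le_nhds
  have hlin : Tendsto (fun t => r + P * (t - τ)) (𝓝[>] τ) (𝓝 r) := by
    have : Continuous fun t => r + P * (t - τ) := by fun_prop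
    have h := this.tendsto τ
    simp only [sub_self, mul_zero, add_zero] at h
    exact h.mono_left nhdsWithin_le_nhds
  have hxlim : Tendsto (fun t => ‖x t‖) (𝓝[>] τ) (𝓝 r) :=
    ((hx.continuousOn.continuousAt (hx.isOpen.mem_nhds hτ)).norm.tendsto).mono_left
      nhdsWithin_le_nhds
  have hlinpos : ∀ᶠ t in 𝓝[>] τ, 0 < r + P * (t - τ) := hlin.eventually (lt_mem_nhds hp)
  -- With h = t - τ, κ = ‖x t‖² - (r + P h)² ~ β h². Dividing by the sum of the two roots gives the
  -- coefficient β/(2r). The angle has cosine (r + P h)/‖x t‖, hence tangent √κ/(r + P h) ~ (√β/r)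
  -- h, which bounds it.
  refine ⟨Real.sqrt β / r, by positivity, ?_, fun ε hε => ?_⟩
  · have h1 : Tendsto (fun t => κ t / (t - τ) ^ 2 / (‖x t‖ + (r + P * (t - τ)))) (𝓝[>] τ)
        (𝓝 (β / (r + r))) := hκlim.div (hxlim.add hlin) (by positivity)
    have e : r * (Real.sqrt β / r) ^ 2 / 2 = β / (r + r) := by
      rw [div_pow, Real.sq_sqrt hβ0]
      field_simp
      norm_num
    rw [e]
    refine h1.congr' ?_
    filter_upwards [hR, hlinpos, self_mem_nhdsWithin] with t h2 h3 ht
    have : t - τ ≠ 0 := (sub_pos.2 ht).ne'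
    have h4 : ‖x t‖ + (r + P * (t - τ)) ≠ 0 := by positivity
    have h5 : κ t = (‖x t‖ - r - P * (t - τ)) * (‖x t‖ + (r + P * (t - τ))) := by linarith
    rw [h5]
    field_simp
  · have h1 : Tendsto (fun t => Real.sqrt (κ t / (t - τ) ^ 2) / (r + P * (t - τ))) (𝓝[>] τ)
        (𝓝 (Real.sqrt β / r)) :=
      ((Real.continuous_sqrt.tendsto _).comp hκlim).div hlin hp.ne'
    filter_upwards [hR, hlinpos, self_mem_nhdsWithin, h1.eventually (gt_mem_nhds (lt_add_of_pos_right _ hε)),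
      (hx.inner_self_eq hτ).filter_mono nhdsWithin_le_nhds] with t h2 h3 ht h4 h5
    have htp : 0 < t - τ := sub_pos.2 ht
    have hxt : 0 < ‖x t‖ := by
      have := hκ0 t
      have : 0 < ‖x t‖ ^ 2 := by rw [h2]; positivity
      exact (norm_nonneg _).lt_of_ne' fun h => by simp [h] at this
    have hang : InnerProductGeometry.angle (x τ) (x t) =
        Real.arccos ((r + P * (t - τ)) / ‖x t‖) := by
      rw [InnerProductGeometry.angle, real_inner_comm, h5, real_inner_self_eq_norm_sq]
      have h3 : P * r = inner ℝ (w τ) (x τ) := div_mul_cancel₀ _ hp.ne'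
      rw [← h3, ← hr]
      congr 1
      field_simp
    rw [hang]
    refine (arccos_le_sqrt_div (by positivity)).trans ?_
    have e1 : 1 - ((r + P * (t - τ)) / ‖x t‖) ^ 2 = κ t / ‖x t‖ ^ 2 := by
      rw [div_pow, eq_div_iff (by positivity), sub_mul, div_mul_cancel₀ _ (by positivity)]
      linarith
    rw [e1, Real.sqrt_div (hκ0 t), Real.sqrt_sq hxt.le, div_div_div_cancel_right₀ hxt.ne']
    rw [Real.sqrt_div (hκ0 t), Real.sqrt_sq htp.le, div_div, mul_comm, ← div_div,
      div_lt_iff₀ htp] at h4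
    exact h4.le

/-- Lower bound for the growth of the radial velocity by the angular speed. -/
theorem eventually_radial_ge (hx : IsFree x I V w) {τ c : ℝ} (hτ : τ ∈ I)
    (hc : Tendsto (fun t => (‖x t‖ - ‖x τ‖ - radial x w τ * (t - τ)) / (t - τ) ^ 2) (𝓝[>] τ)
        (𝓝 c)) {ε : ℝ} (hε : 0 < ε) :
    ∀ᶠ t in 𝓝[>] τ, radial x w τ + (2 * c - ε) * (t - τ) ≤ radial x w t := by
  -- The slope at t is at least the difference quotient of the norm from s = t - δ(t - τ) to t. The
  -- quadratic expansion makes the excess of that quotient over `radial x w τ` about c(2 - δ)(t -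
  -- τ). Small δ keeps the loss cδ below ε/2; the tolerance δε/4 in the expansion allows for the
  -- later division by δ.
  set δ := min 1 (ε / (2 * (|c| + 1))) with hδ
  have hδ0 : 0 < δ := by positivity
  have hδ1 : δ ≤ 1 := min_le_left _ _
  have hcδ : c * δ ≤ ε / 2 := by
    have h1 : δ * (2 * (|c| + 1)) ≤ ε :=
      (le_div_iff₀ (by positivity)).1 (min_le_right 1 (ε / (2 * (|c| + 1))))
    nlinarith [le_abs_self c]
  have hη : 0 < δ * ε / 4 := by positivity
  set B : ℝ → ℝ := fun t => ‖x t‖ - ‖x τ‖ - radial x w τ * (t - τ) with hB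
  have hB1 : ∀ᶠ t in 𝓝[>] τ, (c - δ * ε / 4) * (t - τ) ^ 2 ≤ B t ∧
      B t ≤ (c + δ * ε / 4) * (t - τ) ^ 2 := by
    filter_upwards [hc.eventually (Icc_mem_nhds (sub_lt_self c hη) (lt_add_of_pos_right c hη)),
      self_mem_nhdsWithin] with t ht h0
    have : 0 < (t - τ) ^ 2 := pow_pos (sub_pos.2 h0) 2
    exact ⟨(le_div_iff₀ this).1 ht.1, (div_le_iff₀ this).1 ht.2⟩
  obtain ⟨u, hu, hIoo⟩ := (mem_nhdsGT_iff_exists_Ioo_subset).1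
    (Filter.inter_mem hB1 (mem_nhdsWithin_of_mem_nhds (hx.isOpen.mem_nhds hτ)))
  filter_upwards [Ioo_mem_nhdsGT hu] with t ht
  have hh : 0 < t - τ := sub_pos.2 ht.1
  have htI := (hIoo ht).2
  have hBt := (hIoo ht).1.1
  obtain ⟨s, hs⟩ : ∃ s, s = t - δ * (t - τ) := ⟨_, rfl⟩
  have hsI : s ∈ I :=
    hx.ordConnected.out hτ htI ⟨by nlinarith, by nlinarith⟩
  have hBs : B s ≤ (c + δ * ε / 4) * (s - τ) ^ 2 := by
    rcases hδ1.eq_or_lt with h | h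
    · have : s = τ := by rw [hs, h]; ring
      simp [this, hB]
    · exact (hIoo ⟨by nlinarith, by nlinarith [ht.2]⟩).1.2
  have h1 := hx.norm_add_radial_le htI hsI
  have e : s - τ = (1 - δ) * (t - τ) := by rw [hs]; ring
  rw [e] at hBs
  have h2 : B t - B s ≤ (radial x w t - radial x w τ) * (δ * (t - τ)) := by
    simp only [hB]
    have : s - t = - (δ * (t - τ)) := by rw [hs]; ring
    have e2 : t - τ = (s - τ) + δ * (t - τ) := by rw [hs]; ring
    rw [this] at h1
    have : radial x w τ * (t - τ) = radial x w τ * (s - τ) + radial x w τ * (δ * (t - τ)) := by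
      conv_lhs => rw [e2]
      ring
    linarith
  have h3 : δ * (2 * c - ε) * (t - τ) ^ 2 ≤ (radial x w t - radial x w τ) * (δ * (t - τ)) := by
    refine le_trans ?_ h2
    have h4 : δ * (2 * c - ε) ≤ (c - δ * ε / 4) - (c + δ * ε / 4) * (1 - δ) ^ 2 := by
      have : (c - δ * ε / 4) - (c + δ * ε / 4) * (1 - δ) ^ 2 - δ * (2 * c - ε)
          = δ * (ε - c * δ - ε / 4 * (1 + (1 - δ) ^ 2)) := by ring
      have h5 : (1 - δ) ^ 2 ≤ 1 := by nlinarith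
      have : 0 ≤ δ * (ε - c * δ - ε / 4 * (1 + (1 - δ) ^ 2)) :=
        mul_nonneg hδ0.le (by nlinarith)
      linarith
    nlinarith [mul_le_mul_of_nonneg_right h4 (sq_nonneg (t - τ))]
  have h6 : 0 < δ * (t - τ) := by positivity
  have : (2 * c - ε) * (t - τ) * (δ * (t - τ)) ≤ (radial x w t - radial x w τ) * (δ * (t - τ)) := by
    linarith
  linarith [le_of_mul_le_mul_right this h6]

/-- Turning by an angle costs radial velocity. -/
theorem angle_sq_mul_norm_le (hx : IsFree x I V w) {a b : ℝ} (ha : a ∈ I) (hb : b ∈ I)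
    (hab : a ≤ b) (h0 : x a ≠ 0) (hP : 0 ≤ radial x w a) :
    InnerProductGeometry.angle (x a) (x b) ^ 2 * ‖x a‖ ≤
      (radial x w b - radial x w a) * (b - a) := by
  have hsub : Set.Icc a b ⊆ I := hx.ordConnected.out ha hb
  have hra : 0 < ‖x a‖ := norm_pos_iff.2 h0
  have hge : ∀ t ∈ Set.Icc a b, ‖x a‖ ≤ ‖x t‖ := fun t ht => by
    have h1 := hx.norm_add_radial_le ha (hsub ht)
    have h2 := mul_nonneg hP (sub_nonneg.2 ht.1)
    linarith
  have hne : ∀ t ∈ Set.Icc a b, x t ≠ 0 := fun t ht => norm_pos_iff.1 (hra.trans_le (hge t ht))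
  -- Cauchy–Schwarz in linearized form, which needs no integration: with angular speed c, 2lc ≤ ‖x
  -- a‖c² + l²/‖x a‖, and the radial velocity grows at least at the rate ‖x a‖c².
  have key : ∀ l : ℝ, 0 ≤ l → 2 * l * InnerProductGeometry.angle (x a) (x b) ≤
      radial x w b - radial x w a + l ^ 2 / ‖x a‖ * (b - a) := by
    intro l hl
    have hmain := le_of_lower_right_deriv_nonneg (P := radial x w)
      (g := fun t => l ^ 2 / ‖x a‖ * (t - a) - 2 * l * InnerProductGeometry.angle (x a) (x t))
      hab (hx.radial_monotoneOn.mono hsub) ?_ ?_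
    · simp only [sub_self, mul_zero, InnerProductGeometry.angle_self h0] at hmain
      linarith
    · have hang : ContinuousOn (fun t => InnerProductGeometry.angle (x a) (x t))
          (Set.Icc a b) := by
        intro t ht
        have hc : ContinuousWithinAt x (Set.Icc a b) t := (hx.continuousOn.mono hsub) t ht
        exact (InnerProductGeometry.continuousAt_angle (x := (x a, x t)) h0 (hne t ht)).comp_continuousWithinAt
          (f := fun t => (x a, x t)) (continuousWithinAt_const.prodMk hc)
      fun_prop
    · intro τ hτ ε hε
      have hτ' : τ ∈ Set.Icc a b := ⟨hτ.1, hτ.2.le⟩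
      obtain ⟨c, hc0, hc, hang⟩ := hx.exists_angular_speed (hsub hτ') (hne τ hτ')
      have hε' : 0 < ε / (1 + 2 * l) := by positivity
      filter_upwards [hang _ hε', hx.eventually_radial_ge (hsub hτ') hc hε',
        self_mem_nhdsWithin] with t h1 h2 h3
      have hh : 0 < t - τ := sub_pos.2 h3
      have htri := InnerProductGeometry.angle_le_angle_add_angle (x a) (x τ) (x t)
      have h4 : InnerProductGeometry.angle (x a) (x t) - InnerProductGeometry.angle (x a) (x τ)
        ≤ (c + ε / (1 + 2 * l)) * (t - τ) := by linarith
      have h5 : 2 * l * (InnerProductGeometry.angle (x a) (x t) -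
          InnerProductGeometry.angle (x a) (x τ)) ≤ 2 * l * ((c + ε / (1 + 2 * l)) * (t - τ)) :=
        mul_le_mul_of_nonneg_left h4 (by positivity)
      have h6 : 2 * l * c ≤ ‖x τ‖ * c ^ 2 + l ^ 2 / ‖x a‖ := by
        have h7 : ‖x a‖ * c ^ 2 ≤ ‖x τ‖ * c ^ 2 :=
          mul_le_mul_of_nonneg_right (hge τ hτ') (sq_nonneg c)
        have h8 : 2 * l * c ≤ ‖x a‖ * c ^ 2 + l ^ 2 / ‖x a‖ := by
          have : ‖x a‖ * c ^ 2 + l ^ 2 / ‖x a‖ - 2 * l * c = (‖x a‖ * c - l) ^ 2 / ‖x a‖ := by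
            field_simp
            ring
          have : 0 ≤ (‖x a‖ * c - l) ^ 2 / ‖x a‖ := by positivity
          linarith
        linarith
      have h7 : ε / (1 + 2 * l) * (1 + 2 * l) = ε := div_mul_cancel₀ _ (by positivity)
      set η := ε / (1 + 2 * l)
      have h8 := mul_le_mul_of_nonneg_right h6 hh.le
      rw [← h7]
      nlinarith
  rcases hab.eq_or_lt with rfl | hlt
  · simp [InnerProductGeometry.angle_self h0]
  · have hba : 0 < b - a := sub_pos.2 hlt
    set θ := InnerProductGeometry.angle (x a) (x b)
    have hθ : 0 ≤ θ := InnerProductGeometry.angle_nonneg _ _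
    -- The value of `l` that maximizes 2lθ - l²(b - a)/‖x a‖.
    have h := key (θ * ‖x a‖ / (b - a)) (by positivity)
    have e : (θ * ‖x a‖ / (b - a)) ^ 2 / ‖x a‖ * (b - a) = θ ^ 2 * ‖x a‖ / (b - a) := by
      field_simp
    rw [e] at h
    have e2 : 2 * (θ * ‖x a‖ / (b - a)) * θ = 2 * (θ ^ 2 * ‖x a‖ / (b - a)) := by ring
    rw [e2] at h
    rw [← div_le_iff₀ hba]
    linarith

end IsFree
end Nondet
-- Mass geometry, and trajectories as free curves.
namespace Nondet

variable {n d : ℕ}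

/-- The inner product space in which the mass inner product is realized. -/
abbrev MassSpace (n d : ℕ) : Type := PiLp 2 fun _ : Fin n => EuclideanSpace ℝ (Fin d)

/-- The map `q ↦ (√m i • q i)`, an isometry for the mass inner product. -/
noncomputable def massMap (m : Fin n → ℝ) : Config n d →ₗ[ℝ] MassSpace n d where
  toFun q := WithLp.toLp 2 fun i => Real.sqrt (m i) • q i
  map_add' x y := by ext; simp
  map_smul' c x := by ext; simp; ring

section Geometry

variable {m : Fin n → ℝ}

theorem inner_massMap (hm : ∀ i, 0 < m i) (x y : Config n d) :
    inner ℝ (massMap m x) (massMap m y) = massInner m x y := by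
  rw [PiLp.inner_apply, massInner]
  refine Finset.sum_congr rfl fun i _ => ?_
  change inner ℝ (Real.sqrt (m i) • x i) (Real.sqrt (m i) • y i) = _
  rw [real_inner_smul_left, real_inner_smul_right, ← mul_assoc, Real.mul_self_sqrt (hm i).le]

theorem norm_massMap (hm : ∀ i, 0 < m i) (x : Config n d) : ‖massMap m x‖ = massNorm m x := by
  rw [massNorm, ← inner_massMap hm, real_inner_self_eq_norm_sq, Real.sqrt_sq (norm_nonneg _)]

theorem massMap_injective (hm : ∀ i, 0 < m i) : Function.Injective (massMap (d := d) m) := by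
  intro x y h
  funext i
  have := congrArg (fun z : MassSpace n d => z i) h
  exact smul_right_injective _ (Real.sqrt_ne_zero'.2 (hm i)) this

theorem continuous_massMap : Continuous (massMap (d := d) m) :=
  (PiLp.continuous_toLp 2 _).comp (by fun_prop)

theorem massNorm_ne_zero (hm : ∀ i, 0 < m i) {x : Config n d} : massNorm m x ≠ 0 ↔ x ≠ 0 := by
  rw [← norm_massMap hm, norm_ne_zero_iff, ne_eq, LinearMap.map_eq_zero_iff _ (massMap_injective hm)]

/-- The configurations that are constant on the blocks of `C`. -/
def blockConst (d : ℕ) (C : Setoid (Fin n)) : Submodule ℝ (Config n d) where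
  carrier := {q | ∀ i j, C i j → q i = q j}
  zero_mem' := fun _ _ _ => rfl
  add_mem' := fun ha hb i j h => by simp [ha i j h, hb i j h]
  smul_mem' := fun c a ha i j h => by simp [ha i j h]

theorem blockConst_anti {C C' : Setoid (Fin n)} (h : C ≤ C') :
    blockConst d C' ≤ blockConst d C := fun _ hq _ _ hij => hq _ _ (h hij)

open Classical in
/-- The mass of the block of a particle. -/
noncomputable def blockMass (m : Fin n → ℝ) (C : Setoid (Fin n)) (i : Fin n) : ℝ :=
  ∑ j with C i j, m j

theorem blockMass_pos (hm : ∀ i, 0 < m i) (C : Setoid (Fin n)) (i : Fin n) :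
    0 < blockMass m C i :=
  Finset.sum_pos (fun j _ => hm j) ⟨i, by simp⟩

open Classical in
theorem filter_congr_of_rel {C : Setoid (Fin n)} {i j : Fin n} (h : C i j) :
    Finset.univ.filter (fun k => C i k) = Finset.univ.filter (fun k => C j k) := by
  ext k
  simpa using ⟨fun h' => C.trans (C.symm h) h', fun h' => C.trans h h'⟩

theorem blockMass_congr {C : Setoid (Fin n)} {i j : Fin n} (h : C i j) :
    blockMass m C i = blockMass m C j := by
  classical
  simp only [blockMass, filter_congr_of_rel h]

theorem extProj_mem_blockConst (C : Setoid (Fin n)) (q : Config n d) :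
    extProj m C q ∈ blockConst d C := by
  classical
  intro i j h
  simp only [extProj, filter_congr_of_rel h]

theorem extProj_eq_self (hm : ∀ i, 0 < m i) {C : Setoid (Fin n)} {q : Config n d}
    (hq : q ∈ blockConst d C) : extProj m C q = q := by
  classical
  funext i
  have h : ∑ j with C i j, m j • q j = (∑ j with C i j, m j) • q i := by
    rw [Finset.sum_smul]
    refine Finset.sum_congr rfl fun j hj => ?_
    rw [hq i j (by simpa using hj)]
  simp only [extProj]
  have h0 : ∑ j with C i j, m j ≠ 0 := (blockMass_pos hm C i).ne'
  rw [h, smul_smul, inv_mul_cancel₀ h0, one_smul]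

-- Expansion over pairs in a common block with weights symmetric in the pair, so that entries can be
-- exchanged by `sum_rel_swap`.
open Classical in
theorem massInner_extProj_eq_sum (C : Setoid (Fin n)) (x z : Config n d) :
    massInner m (extProj m C x) z = ∑ i, ∑ j, if C i j then
      m i * m j / blockMass m C i * inner ℝ (x j) (z i) else 0 := by
  simp only [massInner, extProj]
  refine Finset.sum_congr rfl fun i _ => ?_
  rw [real_inner_smul_left, sum_inner, Finset.mul_sum, Finset.mul_sum, ← Finset.sum_filter]
  refine Finset.sum_congr rfl fun j _ => ?_
  rw [real_inner_smul_left, blockMass]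
  ring

open Classical in
theorem massInner_eq_sum (hm : ∀ i, 0 < m i) (C : Setoid (Fin n)) (x z : Config n d) :
    massInner m x z = ∑ i, ∑ j, if C i j then
      m i * m j / blockMass m C i * inner ℝ (x i) (z i) else 0 := by
  simp only [massInner]
  refine Finset.sum_congr rfl fun i _ => ?_
  rw [← Finset.sum_filter]
  have h : ∑ j with C i j, m i * m j / blockMass m C i * inner ℝ (x i) (z i) =
      m i * inner ℝ (x i) (z i) / blockMass m C i * ∑ j with C i j, m j := by
    rw [Finset.mul_sum]
    refine Finset.sum_congr rfl fun j _ => by ring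
  rw [h]
  exact (div_mul_cancel₀ _ (blockMass_pos hm C i).ne').symm

open Classical in
/-- Sums over related pairs are symmetric in the two entries. -/
theorem sum_rel_swap (C : Setoid (Fin n)) (f : Fin n → Fin n → ℝ) :
    (∑ i, ∑ j, if C i j then m i * m j / blockMass m C i * f i j else 0) =
      ∑ i, ∑ j, if C i j then m i * m j / blockMass m C i * f j i else 0 := by
  rw [Finset.sum_comm]
  refine Finset.sum_congr rfl fun i _ => Finset.sum_congr rfl fun j _ => ?_
  by_cases h : C i j
  · rw [if_pos h, if_pos (C.symm h), blockMass_congr h, mul_comm (m i)]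
  · rw [if_neg h, if_neg fun h' => h (C.symm h')]

theorem massInner_extProj (hm : ∀ i, 0 < m i) {C : Setoid (Fin n)} (x : Config n d)
    {z : Config n d} (hz : z ∈ blockConst d C) :
    massInner m (extProj m C x) z = massInner m x z := by
  classical
  rw [massInner_extProj_eq_sum, massInner_eq_sum hm C, sum_rel_swap]
  refine Finset.sum_congr rfl fun i _ => Finset.sum_congr rfl fun j _ => ?_
  split_ifs with h
  · rw [hz i j h]
  · rfl

/-- Chebyshev's inequality in the blocks of a partition. -/
theorem massInner_extProj_le (hm : ∀ i, 0 < m i) (C : Setoid (Fin n)) {x z : Config n d}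
    (h : ∀ i j, C i j → 0 ≤ inner ℝ (x i - x j) (z i - z j)) :
    massInner m (extProj m C x) z ≤ massInner m x z := by
  classical
  have e1 := massInner_extProj_eq_sum (m := m) C x z
  have e2 := massInner_eq_sum hm C x z
  have e1' := e1.trans (sum_rel_swap C fun i j => inner ℝ (x j) (z i))
  have e2' := e2.trans (sum_rel_swap C fun i _ => inner ℝ (x i) (z i))
  -- Adding the difference to its swapped form gives the weighted sum of ⟨x i - x j, z i - z j⟩ over
  -- related pairs.
  have : 0 ≤ (massInner m x z - massInner m (extProj m C x) z) +
      (massInner m x z - massInner m (extProj m C x) z) := by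
    nth_rewrite 1 [e1]
    nth_rewrite 1 [e2]
    rw [e1', e2']
    simp only [← Finset.sum_sub_distrib, ← Finset.sum_add_distrib]
    refine Finset.sum_nonneg fun i _ => Finset.sum_nonneg fun j _ => ?_
    split_ifs with hij
    · have h1 := h i j hij
      have h2 : 0 ≤ m i * m j / blockMass m C i := by
        have := hm i; have := hm j; have := blockMass_pos hm C i
        positivity
      have h3 := mul_nonneg h2 h1
      simp only [inner_sub_left, inner_sub_right] at h3
      linarith
    · simp
  linarith

/-- Distinct positions stay distinct for a short time, so clusters can only split near τ. -/
theorem clusters_eventually_le {q : ℝ → Config n d} {τ : ℝ}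
    (hq : ContinuousAt q τ) : ∀ᶠ t in 𝓝 τ, clusters (q t) ≤ clusters (q τ) := by
  have h : ∀ i j, ∀ᶠ t in 𝓝 τ, q t i = q t j → q τ i = q τ j := by
    intro i j
    by_cases hij : q τ i = q τ j
    · exact .of_forall fun _ _ => hij
    · have hi : ContinuousAt (fun t => q t i) τ := continuousAt_pi.1 hq i
      have hj : ContinuousAt (fun t => q t j) τ := continuousAt_pi.1 hq j
      filter_upwards [((hi.prodMk hj).eventually (isOpen_ne_fun continuous_fst continuous_snd |>.mem_nhds hij))] with t ht h
      exact absurd h ht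
  filter_upwards [eventually_all.2 fun i => eventually_all.2 (h i)] with t ht i j hij
  exact ht i j hij

end Geometry

theorem isOpen_timeInterval (a b : EReal) : IsOpen (timeInterval a b) :=
  (isOpen_Ioi.preimage continuous_coe_real_ereal).inter
    (isOpen_Iio.preimage continuous_coe_real_ereal)

theorem ordConnected_timeInterval (a b : EReal) : (timeInterval a b).OrdConnected :=
  ⟨fun _ hx _ hy _ hz => ⟨hx.1.trans_le (EReal.coe_le_coe_iff.2 hz.1),
    (EReal.coe_le_coe_iff.2 hz.2).trans_lt hy.2⟩⟩

namespace Trajectory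

variable {m : Fin n → ℝ} (γ : Trajectory d m)

/-- The velocity of the barycenters of the clusters. -/
noncomputable def extVelocity (τ : ℝ) : Config n d :=
  deriv (fun s => extProj m (γ.CS τ) (γ.q s)) τ

theorem continuousAt {τ : ℝ} (hτ : τ ∈ γ.I) : ContinuousAt γ.q τ :=
  γ.continuousOn.continuousAt ((isOpen_timeInterval _ _).mem_nhds hτ)

theorem mem_blockConst_CS (τ : ℝ) : γ.q τ ∈ blockConst d (γ.CS τ) := fun _ _ h => h

/-- Locally constant external momentum means locally constant velocity, since masses are nonzero; so
the projected curve is affine. It passes through q(τ), which the projection fixes. -/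
theorem extProj_eq (hm : ∀ i, 0 < m i) {τ : ℝ} (hτ : τ ∈ γ.I) :
    (∀ᶠ t in 𝓝 τ, extProj m (γ.CS τ) (γ.q t) = γ.q τ + (t - τ) • γ.extVelocity τ) ∧
      γ.extVelocity τ ∈ blockConst d (γ.CS τ) := by
  obtain ⟨a, b, hab, -, hC, hev⟩ := γ.ext_free τ hτ
  set f : ℝ → Config n d := fun t => extProj m (γ.CS τ) (γ.q t) with hf
  have hfτ : f τ = γ.q τ := extProj_eq_self hm (γ.mem_blockConst_CS τ)
  have hdiff : DifferentiableOn ℝ f (Set.Ioo a b) := hC.differentiableOn one_ne_zero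
  have hderiv : ∀ᶠ t in 𝓝 τ, deriv f t = γ.extVelocity τ := by
    filter_upwards [hev] with t ht
    funext i
    have h1 : m i • deriv f t i = m i • deriv f τ i := congrFun ht i
    exact smul_right_injective _ (hm i).ne' h1
  obtain ⟨u, v, huv, hIoo⟩ := mem_nhds_iff_exists_Ioo_subset.1
    (Filter.inter_mem (isOpen_Ioo.mem_nhds hab) hderiv)
  have hd : ∀ t ∈ Set.Ioo u v, HasDerivAt f (γ.extVelocity τ) t := fun t ht => by
    have h1 := (hdiff.differentiableAt (isOpen_Ioo.mem_nhds (hIoo ht).1)).hasDerivAt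
    rwa [show deriv f t = γ.extVelocity τ from (hIoo ht).2] at h1
  refine ⟨?_, ?_⟩
  · have hd' : ∀ t ∈ Set.Ioo u v, HasDerivAt (fun t => f t - (t - τ) • γ.extVelocity τ) 0 t :=
      fun t ht => by
        have := (hd t ht).fun_sub (((hasDerivAt_id t).sub_const τ).smul_const (γ.extVelocity τ))
        simpa using this
    filter_upwards [isOpen_Ioo.mem_nhds huv] with t ht
    have h := isOpen_Ioo.is_const_of_deriv_eq_zero isPreconnected_Ioo
      (fun t ht => (hd' t ht).differentiableAt.differentiableWithinAt)
      (fun t ht => (hd' t ht).deriv) ht huv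
    simp only [sub_self, zero_smul, sub_zero, hfτ] at h
    rw [← h]
    simp [hf]
  · intro i j hij
    have h1 := (hasDerivAt_pi.1 (hd τ huv)) i
    have h2 := (hasDerivAt_pi.1 (hd τ huv)) j
    have e : (fun t => f t i) = fun t => f t j := by
      funext t
      exact extProj_mem_blockConst _ _ i j hij
    rw [e] at h1
    exact h1.unique h2

/-- Pairing with a block-constant vector sees only the external projection of q, and that moves
uniformly near τ. -/
theorem isFree (hm : ∀ i, 0 < m i) :
    IsFree (fun t => massMap m (γ.q t)) γ.I (fun t => (blockConst d (γ.CS t)).map (massMap m))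
      fun t => massMap m (γ.extVelocity t) where
  isOpen := isOpen_timeInterval _ _
  ordConnected := ordConnected_timeInterval _ _
  continuousOn := continuous_massMap.comp_continuousOn γ.continuousOn
  mem τ _ := Submodule.mem_map_of_mem (γ.mem_blockConst_CS τ)
  velocity_mem τ hτ := Submodule.mem_map_of_mem (γ.extProj_eq hm hτ).2
  inner_eq τ hτ := by
    filter_upwards [(γ.extProj_eq hm hτ).1] with t ht
    rintro _ ⟨z, hz, rfl⟩
    rw [inner_massMap hm, ← massInner_extProj hm _ hz, ht, ← inner_massMap hm, map_add, map_smul,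
      inner_add_left, real_inner_smul_left]
  le τ hτ := by
    filter_upwards [clusters_eventually_le (γ.continuousAt hτ)] with t ht
    exact Submodule.map_mono (blockConst_anti ht)

theorem PR_eq (hm : ∀ i, 0 < m i) (t : ℝ) :
    γ.PR t = IsFree.radial (fun t => massMap m (γ.q t)) (fun t => massMap m (γ.extVelocity t)) t := by
  simp only [PR, IsFree.radial, inner_massMap hm, norm_massMap hm, pairing, massInner, extMomentum,
    momentum, real_inner_smul_left, extVelocity]

theorem R_eq (hm : ∀ i, 0 < m i) (t : ℝ) : γ.R t = ‖massMap m (γ.q t)‖ := (norm_massMap hm _).symm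

end Trajectory

end Nondet
-- Sphere constants and the turning of a trajectory over a chain.
namespace Nondet

variable {n d : ℕ} {m : Fin n → ℝ}

theorem massInner_smul_smul (a b : ℝ) (x y : Config n d) :
    massInner m (a • x) (b • y) = a * b * massInner m x y := by
  simp only [massInner, Pi.smul_apply, real_inner_smul_left, real_inner_smul_right, Finset.mul_sum]
  exact Finset.sum_congr rfl fun i _ => by ring

theorem inv_massNorm_smul_mem (hm : ∀ i, 0 < m i) {x : Config n d} (hx : x ∈ centered d m)
    (h0 : x ≠ 0) : (massNorm m x)⁻¹ • x ∈ unitSphere d m := by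
  refine ⟨Submodule.smul_mem _ _ hx, ?_⟩
  have h : ‖massMap m x‖ ≠ 0 := by rwa [norm_massMap hm, massNorm_ne_zero hm]
  rw [← norm_massMap hm, ← norm_massMap hm, map_smul, norm_smul, norm_inv, norm_norm,
    inv_mul_cancel₀ h]

theorem sphereDist_nonneg (x : Config n d) (A : Set (Config n d)) : 0 ≤ sphereDist m x A :=
  Real.iInf_nonneg fun _ => Real.arccos_nonneg _

theorem exists_arccos_lt_of_sphereDist_lt {x : Config n d} {A : Set (Config n d)}
    (hA : A.Nonempty) {D : ℝ} (h : sphereDist m x A < D) :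
    ∃ y ∈ A, Real.arccos (massInner m x y) < D := by
  have := hA.to_subtype
  obtain ⟨y, hy⟩ := exists_lt_of_ciInf_lt (show ⨅ y : A, Real.arccos (massInner m x y) < D from h)
  exact ⟨y, y.2, hy⟩

theorem sphereDist_le_angle (hm : ∀ i, 0 < m i) {C : Setoid (Fin n)} {x y : Config n d}
    (hy : y ∈ centered d m) (hyC : y ∈ blockConst d C) (hy0 : y ≠ 0) :
    sphereDist m ((massNorm m x)⁻¹ • x) ((collisionSubspace d m C : Set _) ∩ unitSphere d m) ≤
      InnerProductGeometry.angle (massMap m x) (massMap m y) := by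
  have hyS := inv_massNorm_smul_mem hm hy hy0
  have hyM : (massNorm m y)⁻¹ • y ∈ (collisionSubspace d m C : Set _) ∩ unitSphere d m :=
    ⟨Submodule.smul_mem _ _ ⟨hy, hyC⟩, hyS⟩
  refine (ciInf_le ⟨0, ?_⟩ ⟨_, hyM⟩).trans (le_of_eq ?_)
  · rintro _ ⟨_, rfl⟩
    exact Real.arccos_nonneg _
  · rw [massInner_smul_smul, InnerProductGeometry.angle, inner_massMap hm, norm_massMap hm,
      norm_massMap hm]
    congr 1
    rw [div_eq_mul_inv, mul_inv, mul_comm]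

theorem exists_sphereConst_le (hm : ∀ i, 0 < m i) {K : ℕ} {C : ℕ → Setoid (Fin n)}
    {x : Config n d} (hx : x ∈ centered d m) (h0 : x ≠ 0) :
    ∃ j ≤ K, sphereConst d m K C ≤ sphereDist m ((massNorm m x)⁻¹ • x)
      ((collisionSubspace d m (C j) : Set _) ∩ unitSphere d m) := by
  obtain ⟨j, hj⟩ := exists_eq_ciSup_of_finite (f := fun j : Fin (K + 1) =>
    sphereDist m ((massNorm m x)⁻¹ • x)
      ((collisionSubspace d m (C j) : Set _) ∩ unitSphere d m))
  refine ⟨j, Nat.lt_succ_iff.1 j.2, ?_⟩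
  rw [hj]
  have hbdd : BddBelow (Set.range fun y : unitSphere d m => ⨆ j : Fin (K + 1),
      sphereDist m (y : Config n d)
        ((collisionSubspace d m (C j) : Set _) ∩ unitSphere d m)) := by
    refine ⟨0, ?_⟩
    rintro _ ⟨y, rfl⟩
    exact Real.iSup_nonneg fun _ => sphereDist_nonneg _ _
  exact ciInf_le hbdd ⟨_, inv_massNorm_smul_mem hm hx h0⟩

theorem le_sphereConst_of_exists {K : ℕ} {C : ℕ → Setoid (Fin n)} {D : ℝ}
    (hS : (unitSphere d m).Nonempty)
    (h : ∀ x ∈ unitSphere d m, ∃ j ≤ K, D ≤ sphereDist m x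
      ((collisionSubspace d m (C j) : Set _) ∩ unitSphere d m)) :
    D ≤ sphereConst d m K C := by
  have := hS.to_subtype
  refine le_ciInf fun x => ?_
  obtain ⟨j, hj, hle⟩ := h x x.2
  have hbdd : BddAbove (Set.range fun j : Fin (K + 1) => sphereDist m (x : Config n d)
      ((collisionSubspace d m (C j) : Set _) ∩ unitSphere d m)) := (Set.finite_range _).bddAbove
  exact hle.trans (le_ciSup hbdd ⟨j, Nat.lt_succ_iff.2 hj⟩)

/-- If a function on a finite set changes by at most `ρ` between related points, for each of several
equivalence relations with join `⊤`, then it varies by at most `n ρ`. -/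
theorem norm_sub_le_of_iSup_eq_top {F ι : Type*} [SeminormedAddCommGroup F]
    {C : ι → Setoid (Fin n)} (hC : ⨆ j, C j = ⊤) {x : Fin n → F} {ρ : ℝ} (hρ : 0 ≤ ρ)
    (h : ∀ j, ∀ i k, C j i k → ‖x i - x k‖ ≤ ρ) (i k : Fin n) : ‖x i - x k‖ ≤ n * ρ := by
  classical
  -- Join `⊤` makes this graph connected, and a path has fewer than n edges, each costing at most
  -- `ρ`.
  set G : SimpleGraph (Fin n) := SimpleGraph.fromRel fun i k => ∃ j, C j i k with hG
  have hle : ⨆ j, C j ≤ G.reachableSetoid := by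
    refine iSup_le fun j a b hab => ?_
    by_cases hne : a = b
    · subst hne; exact SimpleGraph.Reachable.refl _
    · exact SimpleGraph.Adj.reachable (by simpa [hG, hne] using Or.inl ⟨j, hab⟩)
  have hr : G.Reachable i k := by
    rw [hC] at hle
    exact hle (x := i) (y := k) trivial
  have hwalk : ∀ {a b : Fin n} (p : G.Walk a b), ‖x a - x b‖ ≤ p.length * ρ := by
    intro a b p
    induction p with
    | nil => simp
    | @cons a b c hadj p ih =>
      have h1 : ‖x a - x b‖ ≤ ρ := by
        simp only [hG, SimpleGraph.fromRel_adj] at hadj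
        rcases hadj.2 with ⟨j, hj⟩ | ⟨j, hj⟩
        · exact h j _ _ hj
        · rw [norm_sub_rev]; exact h j _ _ hj
      have h2 := norm_sub_le_norm_sub_add_norm_sub (x a) (x b) (x c)
      rw [SimpleGraph.Walk.length_cons]
      push_cast
      linarith
  obtain ⟨p, hp⟩ := hr.exists_isPath
  have hlen := hp.length_lt
  rw [Fintype.card_fin] at hlen
  refine (hwalk p).trans (mul_le_mul_of_nonneg_right ?_ hρ)
  exact_mod_cast hlen.le

theorem massInner_self (x : Config n d) : massInner m x x = ∑ i, m i * ‖x i‖ ^ 2 := by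
  simp [massInner]

theorem massNorm_sq (hm : ∀ i, 0 < m i) (x : Config n d) :
    massNorm m x ^ 2 = ∑ i, m i * ‖x i‖ ^ 2 := by
  rw [massNorm, Real.sq_sqrt, massInner_self]
  rw [massInner_self]
  exact Finset.sum_nonneg fun i _ => mul_nonneg (hm i).le (sq_nonneg _)

/-- A point of the unit sphere cannot be close to the collision subspaces of partitions with
join `⊤`; the bound does not depend on the dimension. -/
theorem exists_sphereConst_ge (hm : ∀ i, 0 < m i) :
    ∃ D₀ : ℝ, 0 < D₀ ∧ D₀ ≤ 1 ∧ ∀ (d K : ℕ) (C : ℕ → Setoid (Fin n)),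
      (unitSphere d m).Nonempty → (⨆ j : Fin (K + 1), C j) = ⊤ →
      (∀ j ≤ K, ((collisionSubspace d m (C j) : Set _) ∩ unitSphere d m).Nonempty) →
      D₀ ≤ sphereConst d m K C := by
  obtain ⟨μ, hμ0, hμ⟩ : ∃ μ : ℝ, 0 < μ ∧ ∀ i, μ ≤ m i := by
    rcases isEmpty_or_nonempty (Fin n) with _ | _
    · exact ⟨1, one_pos, fun i => isEmptyElim i⟩
    · obtain ⟨i, hi⟩ := Finite.exists_min m
      exact ⟨m i, hm i, hi⟩
  set Mt := ∑ i, m i with hMt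
  have hMt0 : 0 ≤ Mt := Finset.sum_nonneg fun i _ => (hm i).le
  -- If x were within angle `D₀` of every subspace, related particles would be within ρ = 2D₀/√μ and
  -- any two within nρ. The barycenter is 0, so all ‖x i‖ ≤ nρ, too small for norm 1. The bound by 1
  -- keeps cos D₀ positive.
  set D₀ := min 1 (Real.sqrt μ / (2 * (n + 1) * (Mt + 1))) with hD
  have hD0 : 0 < D₀ := by positivity
  refine ⟨D₀, hD0, min_le_left _ _, fun d K C hS hC hne => ?_⟩
  refine le_sphereConst_of_exists hS fun x hx => ?_
  by_contra! hlt
  have hy : ∀ j ≤ K, ∃ y ∈ (collisionSubspace d m (C j) : Set _) ∩ unitSphere d m,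
      Real.arccos (massInner m x y) < D₀ := fun j hj =>
    exists_arccos_lt_of_sphereDist_lt (hne j hj) (hlt j hj)
  have hxn : ‖massMap m x‖ = 1 := by rw [norm_massMap hm]; exact hx.2
  set ρ := 2 * (D₀ / Real.sqrt μ) with hρ
  have hsμ : 0 < Real.sqrt μ := Real.sqrt_pos.2 hμ0
  have hpair : ∀ j : Fin (K + 1), ∀ i k, C j i k →
      ‖x i - x k‖ ≤ ρ := by
    intro j i k hik
    obtain ⟨y, ⟨hyC, hyS⟩, hyD⟩ := hy j (Nat.lt_succ_iff.1 j.2)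
    have hyn : ‖massMap m y‖ = 1 := by rw [norm_massMap hm]; exact hyS.2
    -- The chord between two unit vectors is no longer than the arc.
    have hcos : 1 - D₀ ^ 2 / 2 ≤ massInner m x y := by
      have hc1 : |massInner m x y| ≤ 1 := by
        rw [← inner_massMap hm]
        have := abs_real_inner_le_norm (massMap m x) (massMap m y)
        rwa [hxn, hyn, one_mul] at this
      have h1 := Real.one_sub_sq_div_two_le_cos (x := Real.arccos (massInner m x y))
      rw [Real.cos_arccos (abs_le.1 hc1).1 (abs_le.1 hc1).2] at h1
      have h2 := Real.arccos_nonneg (massInner m x y)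
      nlinarith
    have hdist : massNorm m (x - y) ^ 2 ≤ D₀ ^ 2 := by
      rw [← norm_massMap hm, map_sub, norm_sub_sq_real, hxn, hyn, inner_massMap hm]
      linarith
    have hcomp : ∀ l, ‖x l - y l‖ ≤ D₀ / Real.sqrt μ := by
      intro l
      rw [le_div_iff₀ hsμ]
      refine le_of_sq_le_sq ?_ hD0.le
      rw [mul_pow, Real.sq_sqrt hμ0.le]
      refine le_trans ?_ hdist
      rw [massNorm_sq hm]
      have h1 := Finset.single_le_sum (f := fun i => m i * ‖(x - y) i‖ ^ 2)
        (fun i _ => mul_nonneg (hm i).le (sq_nonneg _)) (Finset.mem_univ l)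
      refine le_trans ?_ h1
      simp only [Pi.sub_apply]
      nlinarith [hμ l, sq_nonneg ‖x l - y l‖]
    have hyik : y i = y k := hyC.2 i k hik
    have e : x i - x k =
        (x i - y i) - (x k - y k) := by rw [hyik]; abel
    rw [e, hρ]
    have := norm_sub_le (x i - y i) (x k - y k)
    linarith [hcomp i, hcomp k]
  have hall := norm_sub_le_of_iSup_eq_top hC (by positivity) hpair
  have hbound : ∀ i, Mt * ‖x i‖ ≤ Mt * (n * ρ) := by
    intro i
    have h1 : Mt • x i = ∑ k, m k • (x i - x k) := by
      have h2 : ∑ k, m k • x k = 0 := hx.1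
      simp only [smul_sub, Finset.sum_sub_distrib, h2, sub_zero, hMt, Finset.sum_smul]
    have h2 : ‖Mt • x i‖ ≤ ∑ k, m k * (n * ρ) := by
      rw [h1]
      refine (norm_sum_le _ _).trans (Finset.sum_le_sum fun k _ => ?_)
      rw [norm_smul, Real.norm_of_nonneg (hm k).le]
      exact mul_le_mul_of_nonneg_left (hall i k) (hm k).le
    rwa [norm_smul, Real.norm_of_nonneg hMt0, ← Finset.sum_mul] at h2
  have hone : (1 : ℝ) = ∑ i, m i * ‖x i‖ ^ 2 := by
    rw [← massNorm_sq hm, hx.2, one_pow]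
  have hMtpos : 0 < Mt := by
    refine hMt0.lt_of_ne fun h => ?_
    have : ∀ i ∈ Finset.univ, m i = 0 :=
      (Finset.sum_eq_zero_iff_of_nonneg fun i _ => (hm i).le).1 h.symm
    rw [Finset.sum_eq_zero fun i hi => by rw [this i hi, zero_mul]] at hone
    exact one_ne_zero hone
  have hle : (1 : ℝ) ≤ Mt * (n * ρ) ^ 2 := by
    rw [hone, hMt, Finset.sum_mul]
    refine Finset.sum_le_sum fun i _ => mul_le_mul_of_nonneg_left ?_ (hm i).le
    exact pow_le_pow_left₀ (norm_nonneg _) (le_of_mul_le_mul_left (hbound i) hMtpos) 2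
  have hnρ : (n + 1) * ρ * (Mt + 1) ≤ 1 := by
    have h1 : D₀ ≤ Real.sqrt μ / (2 * (n + 1) * (Mt + 1)) := min_le_right _ _
    rw [le_div_iff₀ (by positivity)] at h1
    have : (n + 1) * ρ * (Mt + 1) = D₀ * (2 * (n + 1) * (Mt + 1)) / Real.sqrt μ := by
      rw [hρ]; ring
    rw [this, div_le_one hsμ]
    exact h1
  have hρ0 : 0 < ρ := by positivity
  have h1 : n * ρ * (Mt + 1) < 1 := by nlinarith
  have h2 : 0 ≤ n * ρ := by positivity
  have h3 : n * ρ < 1 := by nlinarith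
  nlinarith

namespace Trajectory

variable {γ : Trajectory d m}

namespace IsChain

variable {s : ℝ} {K : ℕ} {t : ℕ → ℝ}

theorem mem (h : γ.IsChain s K t) (hs : s ∈ γ.I) : ∀ {k}, k ≤ K → t k ∈ γ.I
  | 0, _ => by rwa [h.start]
  | k + 1, hk => (h.step k hk).1.1

theorem lt_succ (h : γ.IsChain s K t) {k : ℕ} (hk : k < K) : t k < t (k + 1) :=
  (h.step k hk).1.2.1

theorem le_of_le (h : γ.IsChain s K t) {j k : ℕ} (hjk : j ≤ k) (hk : k ≤ K) : t j ≤ t k := by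
  induction k, hjk using Nat.le_induction with
  | base => rfl
  | succ k _ ih => exact (ih (by omega)).trans (h.lt_succ hk).le

theorem start_le (h : γ.IsChain s K t) {k : ℕ} (hk : k ≤ K) : s ≤ t k :=
  h.start ▸ h.le_of_le (Nat.zero_le k) hk

/-- By minimality of `t (k + 1)` the join does not grow strictly between two chain times, so the
partitions at the chain times generate it. -/
theorem joinCS_le (h : γ.IsChain s K t) (hs : s ∈ γ.I) {k : ℕ} (hk : k ≤ K) :
    γ.joinCS s (t k) ≤ ⨆ j : Fin (K + 1), γ.CS (t j) := by
  have hle : ∀ j ≤ K, γ.CS (t j) ≤ ⨆ j : Fin (K + 1), γ.CS (t j) := fun j hj =>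
    le_iSup (fun j : Fin (K + 1) => γ.CS (t j)) ⟨j, Nat.lt_succ_iff.2 hj⟩
  induction k with
  | zero =>
    refine iSup₂_le fun u hu => ?_
    rw [h.start, Set.Icc_self] at hu
    rw [Set.mem_singleton_iff.1 hu, ← h.start]
    exact hle 0 (Nat.zero_le _)
  | succ k ih =>
    refine iSup₂_le fun u hu => ?_
    rcases le_or_gt u (t k) with hu1 | hu1
    · exact (le_iSup₂_of_le u ⟨hu.1, hu1⟩ le_rfl).trans (ih (by omega))
    rcases hu.2.eq_or_lt with rfl | hu2
    · exact hle _ hk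
    · have huI : u ∈ γ.I := (ordConnected_timeInterval _ _).out hs (h.mem hs hk) hu
      have h1 : ¬ γ.joinCS s (t k) < γ.joinCS s u := fun hlt =>
        absurd ((h.step k hk).2 ⟨huI, hu1, hlt⟩) (not_le.2 hu2)
      have h2 : γ.joinCS s (t k) ≤ γ.joinCS s u :=
        iSup₂_le fun v hv => le_iSup₂_of_le v ⟨hv.1, hv.2.trans hu1.le⟩ le_rfl
      have h3 : γ.joinCS s u ≤ γ.joinCS s (t k) := by
        by_contra h3
        exact h1 (lt_of_le_not_ge h2 h3)
      exact (le_iSup₂_of_le u ⟨hu.1, le_rfl⟩ le_rfl).trans (h3.trans (ih (by omega)))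

theorem iSup_CS_eq_top (h : γ.IsChain s K t) (hs : s ∈ γ.I) :
    ⨆ j : Fin (K + 1), γ.CS (t j) = ⊤ :=
  top_le_iff.1 (h.closed ▸ h.joinCS_le hs le_rfl)

end IsChain

theorem q_ne_zero_iff (hm : ∀ i, 0 < m i) {t : ℝ} : massMap m (γ.q t) ≠ 0 ↔ γ.q t ≠ 0 := by
  rw [ne_eq, LinearMap.map_eq_zero_iff _ (massMap_injective hm)]

theorem q_ne_zero_of_PR_pos {t : ℝ} (h : 0 < γ.PR t) : γ.q t ≠ 0 := by
  intro h0
  simp [PR, h0, pairing] at h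

variable (hm : ∀ i, 0 < m i)
include hm

theorem PR_mono {s t : ℝ} (hs : s ∈ γ.I) (ht : t ∈ γ.I) (hst : s ≤ t) : γ.PR s ≤ γ.PR t := by
  rw [PR_eq γ hm, PR_eq γ hm]
  exact (γ.isFree hm).radial_monotoneOn hs ht hst

theorem R_add_PR_mul_le {s t : ℝ} (hs : s ∈ γ.I) (ht : t ∈ γ.I) :
    γ.R s + γ.PR s * (t - s) ≤ γ.R t := by
  rw [PR_eq γ hm, R_eq γ hm, R_eq γ hm]
  exact (γ.isFree hm).norm_add_radial_le hs ht

theorem R_pos {s : ℝ} (h : 0 < γ.PR s) : 0 < γ.R s := by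
  rw [R_eq γ hm, norm_pos_iff, q_ne_zero_iff hm]
  exact q_ne_zero_of_PR_pos h

namespace IsChain

variable {s : ℝ} {K : ℕ} {t : ℕ → ℝ}

/-- The direction of q(s) competes in the minimum that defines the constant, so it is far from some
collision subspace of the chain; q visits that subspace at the corresponding time. -/
theorem exists_sphereConst_le_angle (h : γ.IsChain s K t) (hs : s ∈ γ.I) (hP : 0 < γ.PR s) :
    ∃ j ≤ K, sphereConst d m K (fun j => γ.CS (t j)) ≤
      InnerProductGeometry.angle (massMap m (γ.q s)) (massMap m (γ.q (t j))) := by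
  obtain ⟨j, hj, hle⟩ := exists_sphereConst_le (C := fun j => γ.CS (t j)) (K := K) hm
    (γ.mem_centered s hs) (q_ne_zero_of_PR_pos hP)
  have htI := h.mem hs hj
  exact ⟨j, hj, hle.trans (sphereDist_le_angle hm (γ.mem_centered _ htI) (γ.mem_blockConst_CS _)
    (q_ne_zero_of_PR_pos (hP.trans_le (PR_mono hm hs htI (h.start_le hj)))))⟩

/-- The gain of radial momentum over a chain. -/
theorem sq_mul_R_le (h : γ.IsChain s K t) (hs : s ∈ γ.I) (hP : 0 < γ.PR s) {D : ℝ} (hD0 : 0 ≤ D)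
    (hD : D ≤ sphereConst d m K fun j => γ.CS (t j)) :
    D ^ 2 * γ.R s ≤ (γ.PR (t K) - γ.PR s) * (t K - s) := by
  obtain ⟨j, hj, hle⟩ := h.exists_sphereConst_le_angle hm hs hP
  have htI := h.mem hs hj
  have h1 := (γ.isFree hm).angle_sq_mul_norm_le hs htI (h.start_le hj)
    ((q_ne_zero_iff hm).2 (q_ne_zero_of_PR_pos hP)) (by rw [← PR_eq γ hm]; exact hP.le)
  rw [← PR_eq γ hm, ← PR_eq γ hm, ← R_eq γ hm] at h1
  have h2 : D ^ 2 ≤ InnerProductGeometry.angle (massMap m (γ.q s)) (massMap m (γ.q (t j))) ^ 2 :=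
    pow_le_pow_left₀ hD0 (hD.trans hle) 2
  refine (mul_le_mul_of_nonneg_right h2 (R_pos hm hP).le).trans (h1.trans ?_)
  have h3 := PR_mono hm htI (h.mem hs le_rfl) (h.le_of_le hj le_rfl)
  have h4 := PR_mono hm hs htI (h.start_le hj)
  have h5 := h.le_of_le hj le_rfl
  have h6 := h.start_le hj
  exact mul_le_mul (by linarith) (by linarith) (by linarith) (by linarith)

end IsChain

/-- The configurations of a chain keep away from each point of the sphere. -/
theorem le_sphereConst {D₀ : ℝ} (hD : ∀ (d K : ℕ) (C : ℕ → Setoid (Fin n)),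
      (unitSphere d m).Nonempty → (⨆ j : Fin (K + 1), C j) = ⊤ →
      (∀ j ≤ K, ((collisionSubspace d m (C j) : Set _) ∩ unitSphere d m).Nonempty) →
      D₀ ≤ sphereConst d m K C) {s : ℝ} {K : ℕ} {t : ℕ → ℝ} (h : γ.IsChain s K t) (hs : s ∈ γ.I)
    (hP : 0 < γ.PR s) : D₀ ≤ sphereConst d m K fun j => γ.CS (t j) := by
  -- The intersections must be nonempty: `sphereDist` to the empty set has the default value 0.
  -- Positive radial momentum keeps q away from 0.
  have hmem : ∀ j ≤ K, (massNorm m (γ.q (t j)))⁻¹ • γ.q (t j) ∈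
      (collisionSubspace d m (γ.CS (t j)) : Set _) ∩ unitSphere d m := fun j hj => by
    have htI := h.mem hs hj
    have h0 := q_ne_zero_of_PR_pos (hP.trans_le (PR_mono hm hs htI (h.start_le hj)))
    exact ⟨Submodule.smul_mem _ _ ⟨γ.mem_centered _ htI, γ.mem_blockConst_CS _⟩,
      inv_massNorm_smul_mem hm (γ.mem_centered _ htI) h0⟩
  exact hD d K _ ⟨_, (hmem 0 (Nat.zero_le _)).2⟩ (h.iSup_CS_eq_top hs) fun j hj => ⟨_, hmem j hj⟩

end Trajectory

end Nondet
-- Growth of sequences obeying the two chain inequalities.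
namespace Nondet

section Counting

theorem ncard_eq_sum (ℓ : ℕ) (p : ℕ → Prop) [DecidablePred p] :
    {i : ℕ | 1 ≤ i ∧ 2 * i ≤ ℓ ∧ p i}.ncard =
      ∑ i ∈ Finset.Icc 1 (ℓ / 2), if p i then 1 else 0 := by
  rw [← Finset.card_filter, ← Set.ncard_coe_finset]
  congr 1
  ext i
  simp only [Set.mem_ofPred_eq, Finset.coe_filter, Finset.mem_Icc]
  have : 2 * i ≤ ℓ ↔ i ≤ ℓ / 2 := by omega
  rw [this, and_assoc]

theorem countG_eq_sum (T : ℕ → ℝ) (ℓ : ℕ) : countG T ℓ = ∑ i ∈ Finset.Icc 1 (ℓ / 2),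
    open Classical in if gap T (2 * i - 1) ≤ gap T (2 * i) then 1 else 0 := by
  classical
  exact ncard_eq_sum ℓ fun i => gap T (2 * i - 1) ≤ gap T (2 * i)

theorem countU_eq_sum (T : ℕ → ℝ) (ℓ : ℕ) : countU T ℓ = ∑ i ∈ Finset.Icc 1 (ℓ / 2),
    open Classical in if gap T (2 * i) ≤ gap T (2 * i - 1) then 1 else 0 := by
  classical
  exact ncard_eq_sum ℓ fun i => gap T (2 * i) ≤ gap T (2 * i - 1)

theorem half_le_countU_add_countG (T : ℕ → ℝ) (ℓ : ℕ) : ℓ / 2 ≤ countU T ℓ + countG T ℓ := by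
  classical
  rw [countU_eq_sum, countG_eq_sum, ← Finset.sum_add_distrib]
  calc ℓ / 2 = ∑ i ∈ Finset.Icc 1 (ℓ / 2), 1 := by simp
    _ ≤ _ := Finset.sum_le_sum fun i _ => by
      rcases le_total (gap T (2 * i)) (gap T (2 * i - 1)) with h | h <;> simp [h]

/-- If `P (2 i) ≥ c P (2 i - 2)` for those `i` which are counted and `P` does not decrease, then
`P` grows exponentially in the count. -/
theorem mul_pow_sum_le {P : ℕ → ℝ} (hP : Monotone P) {c : ℝ} (hc : 0 ≤ c) {p : ℕ → Prop}
    [DecidablePred p] (h : ∀ k, p (k + 1) → P (2 * k) * c ≤ P (2 * k + 2)) (ℓ : ℕ) :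
    P 0 * c ^ (∑ i ∈ Finset.Icc 1 (ℓ / 2), if p i then 1 else 0) ≤ P ℓ := by
  refine le_trans ?_ (hP (Nat.mul_div_le ℓ 2))
  induction ℓ / 2 with
  | zero => simp
  | succ k ih =>
    rw [Finset.sum_Icc_succ_top (by omega)]
    split_ifs with hk
    · rw [pow_succ, ← mul_assoc]
      exact (mul_le_mul_of_nonneg_right ih hc).trans (h k hk)
    · exact ih.trans (hP (by omega))

/-- The relations between radial momenta, radii and chain-closing times. -/
structure IsGrowing (D : ℝ) (P R T : ℕ → ℝ) : Prop where
  P_pos : ∀ ℓ, 0 < P ℓ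
  R_pos : ∀ ℓ, 0 < R ℓ
  T_mono : ∀ ℓ, T ℓ ≤ T (ℓ + 1)
  P_mono : ∀ ℓ, P ℓ ≤ P (ℓ + 1)
  R_ge : ∀ ℓ, R ℓ + P ℓ * (T (ℓ + 1) - T ℓ) ≤ R (ℓ + 1)
  P_ge : ∀ ℓ, D ^ 2 * R ℓ ≤ (P (ℓ + 1) - P ℓ) * (T (ℓ + 1) - T ℓ)

namespace IsGrowing

variable {D : ℝ} {P R T : ℕ → ℝ}

theorem R_mono (h : IsGrowing D P R T) (ℓ : ℕ) : R ℓ ≤ R (ℓ + 1) := by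
  have := h.R_ge ℓ
  have := mul_nonneg (h.P_pos ℓ).le (sub_nonneg.2 (h.T_mono ℓ))
  linarith

/-- The first gap makes the radius at least P_k times the second gap; `P_ge` for the second chain
then gives a gain of D²P_k after division by that gap. -/
theorem P_step (h : IsGrowing D P R T) (k : ℕ)
    (hk : T (k + 2) - T (k + 1) ≤ T (k + 1) - T k) : P k * (1 + D ^ 2) ≤ P (k + 2) := by
  have h1 := h.P_ge (k + 1)
  have h2 := h.R_ge k
  have h3 := mul_le_mul_of_nonneg_left hk (h.P_pos k).le
  have h4 := h.R_pos k
  have h5 := h.P_mono k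
  have h6 := sub_nonneg.2 (h.T_mono (k + 1))
  -- A vanishing second gap would forbid the division, but then `P_ge` forces D = 0.
  rcases h6.eq_or_lt with h7 | h7
  · rw [show k + 1 + 1 = k + 2 from rfl] at h1 h7
    rw [← h7, mul_zero] at h1
    have h8 := h.R_pos (k + 1)
    have : D ^ 2 = 0 := by
      have := sq_nonneg D
      by_contra hne
      have : 0 < D ^ 2 := by positivity
      nlinarith
    have := h.P_mono (k + 1)
    rw [‹D ^ 2 = 0›]
    linarith
  · have h8 : D ^ 2 * P k * (T (k + 2) - T (k + 1)) ≤
        (P (k + 2) - P (k + 1)) * (T (k + 2) - T (k + 1)) := by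
      refine le_trans ?_ h1
      rw [mul_assoc]
      exact mul_le_mul_of_nonneg_left (by linarith) (sq_nonneg D)
    have := le_of_mul_le_mul_right h8 h7
    linarith

/-- The momentum gained in the first chain acts during the longer second gap and adds at least D²R_k
to the radius. -/
theorem R_step (h : IsGrowing D P R T) (k : ℕ)
    (hk : T (k + 1) - T k ≤ T (k + 2) - T (k + 1)) : R k * (1 + D ^ 2) ≤ R (k + 2) := by
  have h1 := h.P_ge k
  have h2 := h.R_ge (k + 1)
  have h3 := h.R_mono k
  have h4 := mul_nonneg (h.P_pos k).le (sub_nonneg.2 (h.T_mono k))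
  have h5 := mul_le_mul_of_nonneg_left hk (h.P_pos (k + 1)).le
  rw [show k + 1 + 1 = k + 2 from rfl] at h2
  linarith

theorem P_exp (h : IsGrowing D P R T) (ℓ : ℕ) : P 0 * (1 + D ^ 2) ^ countU T ℓ ≤ P ℓ := by
  classical
  rw [countU_eq_sum]
  refine mul_pow_sum_le (p := fun i => gap T (2 * i) ≤ gap T (2 * i - 1))
    (monotone_nat_of_le_succ h.P_mono) (by positivity) (fun k hk => h.P_step _ ?_) ℓ
  simpa [gap, mul_add] using hk

theorem R_exp (h : IsGrowing D P R T) (ℓ : ℕ) : R 0 * (1 + D ^ 2) ^ countG T ℓ ≤ R ℓ := by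
  classical
  rw [countG_eq_sum]
  refine mul_pow_sum_le (p := fun i => gap T (2 * i - 1) ≤ gap T (2 * i))
    (monotone_nat_of_le_succ h.R_mono) (by positivity) (fun k hk => h.R_step _ ?_) ℓ
  simpa [gap, mul_add] using hk

/-- Every pair of gaps is counted in `countU` or in `countG`, so the product gains whichever factor
does. -/
theorem mul_exp (h : IsGrowing D P R T) (ℓ : ℕ) :
    P 0 * R 0 * (1 + D ^ 2) ^ (ℓ / 2) ≤ P ℓ * R ℓ := by
  have h1 := mul_le_mul (h.P_exp ℓ) (h.R_exp ℓ)
    (mul_nonneg (h.R_pos 0).le (by positivity)) (h.P_pos ℓ).le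
  refine le_trans ?_ h1
  rw [mul_mul_mul_comm, ← pow_add]
  refine mul_le_mul_of_nonneg_left ?_ (mul_pos (h.P_pos 0) (h.R_pos 0)).le
  exact pow_le_pow_right₀ (by nlinarith [sq_nonneg D]) (half_le_countU_add_countG T ℓ)

theorem gap_nonneg (h : IsGrowing D P R T) (ℓ : ℕ) : 0 ≤ gap T ℓ := by
  cases ℓ with
  | zero => simp [gap]
  | succ ℓ => simpa [gap] using h.T_mono ℓ

/-- Exponential growth of `P` if the gaps are bounded. -/
theorem P_exp_of_gap_le (h : IsGrowing D P R T) {c L : ℝ} (hc : 1 ≤ c) (hcD : c ^ 4 = 1 + D ^ 2)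
    (hL : 0 < L) {ℓ : ℕ} (hg : gap T (ℓ + 1) ≤ L) :
    Real.sqrt (D ^ 2 * (P 0 * R 0) / L / c ^ 4) * c ^ (ℓ + 1) ≤ P (ℓ + 1) := by
  have hPR := mul_pos (h.P_pos 0) (h.R_pos 0)
  have hc0 : 0 < c := by linarith
  refine le_of_sq_le_sq ?_ (h.P_pos _).le
  rw [mul_pow, Real.sq_sqrt (by positivity)]
  have hg' : T (ℓ + 1) - T ℓ ≤ L := by simpa [gap] using hg
  have h1 : D ^ 2 * R ℓ ≤ P (ℓ + 1) * L :=
    (h.P_ge ℓ).trans (mul_le_mul (by linarith [h.P_pos ℓ]) hg' (sub_nonneg.2 (h.T_mono ℓ))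
      (h.P_pos _).le)
  have h2 : D ^ 2 * (P ℓ * R ℓ) ≤ P (ℓ + 1) ^ 2 * L := by
    have h3 := mul_le_mul_of_nonneg_left h1 (h.P_pos ℓ).le
    have h4 := mul_le_mul_of_nonneg_right (h.P_mono ℓ)
      (mul_nonneg (h.P_pos (ℓ + 1)).le hL.le)
    calc D ^ 2 * (P ℓ * R ℓ) = P ℓ * (D ^ 2 * R ℓ) := by ring
      _ ≤ P (ℓ + 1) * (P (ℓ + 1) * L) := h3.trans h4
      _ = _ := by ring
  have h5 := mul_le_mul_of_nonneg_left (h.mul_exp ℓ) (sq_nonneg D)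
  rw [← hcD, ← pow_mul] at h5
  -- The extra c⁴ pays for the rounding in ℓ / 2 and for the shift to ℓ + 1.
  have h6 : (c ^ (ℓ + 1)) ^ 2 ≤ c ^ (4 * (ℓ / 2)) * c ^ 4 := by
    rw [← pow_mul, ← pow_add]
    exact pow_le_pow_right₀ hc (by omega)
  calc D ^ 2 * (P 0 * R 0) / L / c ^ 4 * (c ^ (ℓ + 1)) ^ 2
      ≤ D ^ 2 * (P 0 * R 0) / L / c ^ 4 * (c ^ (4 * (ℓ / 2)) * c ^ 4) :=
        mul_le_mul_of_nonneg_left h6 (by positivity)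
    _ = D ^ 2 * (P 0 * R 0 * c ^ (4 * (ℓ / 2))) / L := by field_simp
    _ ≤ P (ℓ + 1) ^ 2 := by rw [div_le_iff₀ hL]; exact h5.trans h2

end IsGrowing

end Counting

/-! ### Application to chain-closing times, and order-preserving motion on a line. -/

namespace Trajectory

variable {n d : ℕ} {m : Fin n → ℝ}

theorem zero_mem (γ : Trajectory d m) : (0 : ℝ) ∈ γ.I := ⟨γ.Tminus_neg, γ.Tplus_pos⟩

variable {γ : Trajectory d m} {T : ℕ → ℝ} {K : ℕ → ℕ} {t : ℕ → ℕ → ℝ}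

theorem IsChainClosing.le_succ (h : γ.IsChainClosing T K t) (ℓ : ℕ) : T ℓ ≤ T (ℓ + 1) :=
  h.succ ℓ ▸ (h.chain ℓ).start_le le_rfl

theorem IsChainClosing.mem (h : γ.IsChainClosing T K t) : ∀ ℓ, T ℓ ∈ γ.I
  | 0 => h.zero ▸ γ.zero_mem
  | ℓ + 1 => h.succ ℓ ▸ (h.chain ℓ).mem (h.mem ℓ) le_rfl

theorem IsChainClosing.nonneg (h : γ.IsChainClosing T K t) : ∀ ℓ, 0 ≤ T ℓ
  | 0 => h.zero.ge
  | ℓ + 1 => (h.nonneg ℓ).trans (h.le_succ ℓ)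

theorem IsChainClosing.PR_pos (h : γ.IsChainClosing T K t) (hm : ∀ i, 0 < m i)
    (hP : 0 < γ.PR 0) (ℓ : ℕ) : 0 < γ.PR (T ℓ) :=
  hP.trans_le (PR_mono hm γ.zero_mem (h.mem ℓ) (h.nonneg ℓ))

theorem IsChainClosing.isGrowing (h : γ.IsChainClosing T K t) (hm : ∀ i, 0 < m i)
    (hP : 0 < γ.PR 0) {D : ℝ} (hD0 : 0 ≤ D)
    (hD : ∀ ℓ, D ≤ sphereConst d m (K ℓ) fun j => γ.CS (t ℓ j)) :
    IsGrowing D (fun ℓ => γ.PR (T ℓ)) (fun ℓ => γ.R (T ℓ)) T where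
  P_pos := h.PR_pos hm hP
  R_pos ℓ := Trajectory.R_pos hm (h.PR_pos hm hP ℓ)
  T_mono := h.le_succ
  P_mono ℓ := PR_mono hm (h.mem ℓ) (h.mem (ℓ + 1)) (h.le_succ ℓ)
  R_ge ℓ := R_add_PR_mul_le hm (h.mem ℓ) (h.mem (ℓ + 1))
  P_ge ℓ := by
    rw [h.succ ℓ]
    exact (h.chain ℓ).sq_mul_R_le hm (h.mem ℓ) (h.PR_pos hm hP ℓ) hD0 (hD ℓ)

/-- On a line, if the order of the particles never changes, the configurations at later times lie
beyond the hyperplane through the configuration at time `s` that is orthogonal to it. -/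
theorem OrderPreserving.sq_le_massInner {γ : Trajectory 1 m} (hγ : γ.OrderPreserving)
    (hm : ∀ i, 0 < m i) {s u : ℝ} (hs : s ∈ γ.I) (hs0 : 0 ≤ s) (hu : u ∈ γ.I) (hsu : s ≤ u)
    (hP : 0 < γ.PR s) : γ.R s ^ 2 ≤ massInner m (γ.q u) (γ.q s) := by
  have hsub : Set.Icc s u ⊆ γ.I := (ordConnected_timeInterval _ _).out hs hu
  have hfree := γ.isFree hm
  have hconv : ConvexOn ℝ (Set.Icc s u)
      fun v => inner ℝ (massMap m (γ.q v)) (massMap m (γ.q s)) := by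
    refine convexOn_of_local_support (convex_Icc s u) ?_ fun τ hτ => ?_
    · exact (hfree.continuousOn.mono hsub).inner continuousOn_const
    · rw [interior_Icc] at hτ
      have hτI := hsub (Set.Ioo_subset_Icc_self hτ)
      refine ⟨massInner m (γ.extVelocity τ) (γ.q s), ?_⟩
      filter_upwards [(γ.extProj_eq hm hτI).1, Icc_mem_nhds hτ.1 hτ.2] with v hv hvI
      -- Fixed order makes q(v) and q(s) similarly ordered, so projecting q(v) can only lower the
      -- inner product. The projected curve is affine near τ and supplies the supporting line.
      have hcheb := massInner_extProj_le hm (γ.CS τ) (x := γ.q v) (z := γ.q s) fun i j _ => by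
        have e : inner ℝ (γ.q v i - γ.q v j) (γ.q s i - γ.q s j) =
            (γ.q s i 0 - γ.q s j 0) * (γ.q v i 0 - γ.q v j 0) := by
          simp [PiLp.inner_apply]
        rw [e]
        have hvi := hsub hvI
        have hv0 := hs0.trans hvI.1
        rcases lt_trichotomy (γ.q s i 0) (γ.q s j 0) with hlt | heq | hlt
        · have := hγ s hs v hvi hs0 hv0 i j hlt
          nlinarith
        · simp [heq]
        · have := hγ s hs v hvi hs0 hv0 j i hlt
          nlinarith
      rw [hv, ← inner_massMap hm, ← inner_massMap hm, map_add, map_smul, inner_add_left,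
        real_inner_smul_left] at hcheb
      rw [← inner_massMap hm]
      linarith
  have h1 := hconv.add_mul_sub_le (τ := s) (t := u)
    (s := inner ℝ (massMap m (γ.extVelocity s)) (massMap m (γ.q s))) ⟨le_rfl, hsu⟩
    (((hfree.inner_self_eq hs).mono fun v hv => hv.ge).filter_mono nhdsWithin_le_nhds) ⟨hsu, le_rfl⟩
  have h2 : 0 ≤ inner ℝ (massMap m (γ.extVelocity s)) (massMap m (γ.q s)) := by
    rw [PR_eq γ hm, IsFree.radial] at hP
    by_contra! hneg
    exact absurd hP (not_lt.2 (div_nonpos_of_nonpos_of_nonneg hneg.le (norm_nonneg _)))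
  rw [R_eq γ hm, ← real_inner_self_eq_norm_sq, ← inner_massMap hm]
  have := mul_nonneg h2 (sub_nonneg.2 hsu)
  linarith

/-- At a chain time t_j where q has turned by at least D, the cosine of the angle is at most cos D,
but at least R(s)/R(t_j) by `OrderPreserving.sq_le_massInner`. -/
theorem OrderPreserving.R_ge {γ : Trajectory 1 m} (hγ : γ.OrderPreserving) (hm : ∀ i, 0 < m i)
    {s : ℝ} {K : ℕ} {t : ℕ → ℝ} (h : γ.IsChain s K t) (hs : s ∈ γ.I) (hs0 : 0 ≤ s)
    (hP : 0 < γ.PR s) {D : ℝ} (hD0 : 0 ≤ D) (hD1 : D ≤ 1)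
    (hD : D ≤ sphereConst 1 m K fun j => γ.CS (t j)) :
    (Real.cos D)⁻¹ * γ.R s ≤ γ.R (t K) := by
  obtain ⟨j, hj, hle⟩ := h.exists_sphereConst_le_angle hm hs hP
  have htI := h.mem hs hj
  have hRs := R_pos hm hP
  have hcos : 0 < Real.cos D := Real.cos_pos_of_le_one (by rwa [abs_of_nonneg hD0])
  have hPj := hP.trans_le (PR_mono hm hs htI (h.start_le hj))
  have hRj := R_pos hm hPj
  have h1 := hγ.sq_le_massInner hm hs hs0 htI (h.start_le hj) hP
  have h2 := Real.cos_le_cos_of_nonneg_of_le_pi hD0 (InnerProductGeometry.angle_le_pi _ _)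
    (hD.trans hle)
  rw [InnerProductGeometry.cos_angle, real_inner_comm, inner_massMap hm, ← R_eq γ hm, ← R_eq γ hm,
    div_le_iff₀ (mul_pos hRs hRj)] at h2
  have h3 : γ.R s ≤ Real.cos D * γ.R (t j) := by
    refine le_of_mul_le_mul_right ?_ hRs
    calc γ.R s * γ.R s = γ.R s ^ 2 := by ring
      _ ≤ _ := h1.trans h2
      _ = _ := by ring
  have h4 : γ.R (t j) ≤ γ.R (t K) := by
    have h5 := R_add_PR_mul_le hm htI (h.mem hs le_rfl)
    have h6 := mul_nonneg hPj.le (sub_nonneg.2 (h.le_of_le hj le_rfl))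
    linarith
  rw [inv_mul_le_iff₀ hcos]
  exact h3.trans (mul_le_mul_of_nonneg_left h4 hcos.le)

end Trajectory

end Nondet

theorem theorem3p15 {n : ℕ} (m : Fin n → ℝ) (hm : ∀ i, 0 < m i) :
    (∃ D₀ : ℝ, 0 < D₀ ∧
      ∀ (d : ℕ) (γ : Nondet.Trajectory d m) (T : ℕ → ℝ) (K : ℕ → ℕ) (t : ℕ → ℕ → ℝ),
        γ.IsChainClosing T K t → 0 < γ.PR 0 →
          D₀ ≤ γ.chainConst K t ∧
          ∀ ℓ : ℕ,
            γ.PR 0 * (1 + γ.chainConst K t ^ 2) ^ Nondet.countU T ℓ ≤ γ.PR (T ℓ) ∧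
            γ.R 0 * (1 + γ.chainConst K t ^ 2) ^ Nondet.countG T ℓ ≤ γ.R (T ℓ)) ∧
    (∃ C_P : ℝ, 1 < C_P ∧ ∃ A : ℝ → ℝ → ℝ → ℝ,
      (∀ P R L : ℝ, 0 < P → 0 < R → 0 ≤ L → 0 < A P R L) ∧
      ∀ (d : ℕ) (γ : Nondet.Trajectory d m) (T : ℕ → ℝ) (K : ℕ → ℕ) (t : ℕ → ℕ → ℝ),
        γ.IsChainClosing T K t → 0 < γ.PR 0 →
          Filter.limsup (fun ℓ => (Nondet.gap T ℓ : EReal)) Filter.atTop < ⊤ →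
          ∀ᶠ ℓ : ℕ in Filter.atTop,
            A (γ.PR 0) (γ.R 0)
              (Filter.limsup (fun ℓ => (Nondet.gap T ℓ : EReal)) Filter.atTop).toReal * C_P ^ ℓ
              ≤ γ.PR (T ℓ)) ∧
    (∃ C_R : ℝ, 1 < C_R ∧
      ∀ (γ : Nondet.Trajectory 1 m) (T : ℕ → ℝ) (K : ℕ → ℕ) (t : ℕ → ℕ → ℝ),
        γ.IsChainClosing T K t → 0 < γ.PR 0 → γ.OrderPreserving →
          ∀ ℓ : ℕ, C_R * γ.R (T ℓ) ≤ γ.R (T (ℓ + 1))) := by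
  obtain ⟨D₀, hD0, hD1, hD⟩ := Nondet.exists_sphereConst_ge hm
  have hle : ∀ {d : ℕ} {γ : Nondet.Trajectory d m} {T : ℕ → ℝ} {K : ℕ → ℕ} {t : ℕ → ℕ → ℝ},
      γ.IsChainClosing T K t → 0 < γ.PR 0 →
      ∀ ℓ, D₀ ≤ Nondet.sphereConst d m (K ℓ) fun j => γ.CS (t ℓ j) := fun h hP ℓ =>
    Nondet.Trajectory.le_sphereConst hm hD (h.chain ℓ) (h.mem ℓ) (h.PR_pos hm hP ℓ)
  refine ⟨⟨D₀, hD0, fun d γ T K t h hP => ?_⟩, ?_, (Real.cos D₀)⁻¹, ?_, fun γ T K t h hP hγ ℓ => ?_⟩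
  · have hDc : D₀ ≤ γ.chainConst K t := le_ciInf (hle h hP)
    have hgrow := h.isGrowing hm hP (hD0.le.trans hDc) fun ℓ =>
      ciInf_le ⟨D₀, by rintro _ ⟨ℓ, rfl⟩; exact hle h hP ℓ⟩ ℓ
    refine ⟨hDc, fun ℓ => ?_⟩
    have h1 := hgrow.P_exp ℓ
    have h2 := hgrow.R_exp ℓ
    simp only [h.zero] at h1 h2
    exact ⟨h1, h2⟩
  -- A fourth root: PR gains 1 + D₀² once per two chains, and bounded gaps make P² comparable to PR.
  · obtain ⟨c, hc, hcD⟩ : ∃ c : ℝ, 1 < c ∧ c ^ 4 = 1 + D₀ ^ 2 := by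
      have h1 : 1 < 1 + D₀ ^ 2 := by nlinarith
      refine ⟨Real.sqrt (Real.sqrt (1 + D₀ ^ 2)), ?_, ?_⟩
      · rw [Real.lt_sqrt zero_le_one, Real.lt_sqrt (by positivity)]
        simpa using h1
      · rw [show 4 = 2 * 2 from rfl, pow_mul, Real.sq_sqrt (Real.sqrt_nonneg _),
          Real.sq_sqrt (by positivity)]
    -- Gaps lie below L + 1 from some index on, while L itself need not bound them and may be 0.
    refine ⟨c, hc, fun P R L => Real.sqrt (D₀ ^ 2 * (P * R) / (L + 1) / c ^ 4),
      fun P R L hP hR hL => by positivity, fun d γ T K t h hP hlim => ?_⟩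
    -- Here `D₀` replaces the constant of the trajectory, so that the rate depends on n and the
    -- masses only.
    have hgrow := h.isGrowing hm hP hD0.le (hle h hP)
    set L := Filter.limsup (fun ℓ => (Nondet.gap T ℓ : EReal)) Filter.atTop with hL
    have hL0 : 0 ≤ L := by
      have h1 := Filter.limsup_le_limsup (f := Filter.atTop) (u := fun _ : ℕ => (0 : EReal))
        (v := fun ℓ => (Nondet.gap T ℓ : EReal))
        (.of_forall fun ℓ => EReal.coe_nonneg.2 (hgrow.gap_nonneg ℓ))
      rwa [Filter.limsup_const] at h1
    have hLr : (L.toReal : EReal) = L :=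
      EReal.coe_toReal hlim.ne (EReal.bot_lt_zero.trans_le hL0).ne'
    have hLr0 : 0 ≤ L.toReal := EReal.toReal_nonneg hL0
    have hev : ∀ᶠ ℓ in Filter.atTop, (Nondet.gap T ℓ : EReal) < ((L.toReal + 1 : ℝ) : EReal) := by
      refine Filter.eventually_lt_of_limsup_lt ?_
      rw [← hL]
      conv_lhs => rw [← hLr]
      exact EReal.coe_lt_coe_iff.2 (lt_add_one _)
    filter_upwards [hev, Filter.eventually_ge_atTop 1] with ℓ hℓ hℓ1
    obtain ⟨k, rfl⟩ := Nat.exists_eq_add_of_le' hℓ1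
    have h1 := hgrow.P_exp_of_gap_le hc.le hcD (by positivity : 0 < L.toReal + 1)
      (EReal.coe_lt_coe_iff.1 hℓ).le
    simp only [h.zero] at h1
    exact h1
  · have hcos : 0 < Real.cos D₀ := Real.cos_pos_of_le_one (by rwa [abs_of_pos hD0])
    rw [one_lt_inv₀ hcos, ← Real.cos_zero]
    exact Real.cos_lt_cos_of_nonneg_of_le_pi le_rfl (by linarith [Real.pi_gt_three]) hD0
  · rw [h.succ ℓ]
    exact hγ.R_ge hm (h.chain ℓ) (h.mem ℓ) (h.nonneg ℓ) (h.PR_pos hm hP ℓ) hD0.le hD1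
      (hle h hP ℓ)
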